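/- **Conventions.** A digraph $X$ consists of a set $X_0$ of vertices and a set $A(X)$ of arrows, which are ordered pairs of distinct vertices; put $X_1=A(X)\cup\{(x,x)\mid x\in X_0\}$. A morphism $X\to Y$ is a map $X_0\to Y_0$ sending $X_1$ to $Y_1$. An $n$-path from $x$ to $y$ is a sequence $(x_0,\dots,x_n)$ with $x_0=x$, $x_n=y$ and all $(x_i,x_{i+1})\in X_1$; $\mathsf{dist}(x,y)\in\mathbb N\cup\{\infty\}$ is the minimal length of a path from $x$ to $y$. $D_n(X)$ is the digraph with vertex set $X_0$ and $D_n(X)_1=\{(x,y)\mid \mathsf{dist}(x,y)\le n\}$. A morphism $p:E\to X$ is a $1$-covering if for every $(x,y)\in X_1$, every $e\in p^{-1}(x)$ and every $e'\in p^{-1}(y)$ there are a unique $\tilde e\in p^{-1}(y)$ with $(e,\tilde e)\in E_1$ and a unique $\tilde e'\in p^{-1}(x)$ with $(\tilde e',e')\in E_1$; it is an $l$-covering if $D_n(p)$ is a $1$-covering for all $1\le n\le l$. ${\sf Cov}_l(X)$ is the full subcategory of digraphs over $X$ on the $l$-coverings. $\mathscr N^l(X)$ is the simplicial set whose $n$-simplices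 are the sequences $(x_0,\dots,x_n)$ of vertices with $\sum_i\mathsf{dist}(x_i,x_{i+1})\le l$. A morphism of simplicial sets is a covering if it has the unique right lifting property with respect to all vertex inclusions $\Delta^0\to\Delta^m$; a morphism of groupoids is a covering if every morphism of the base lifts uniquely once a lift of its source, or of its target, is given. ${\sf Cov}(-)$ denotes the full subcategory of the slice category on the coverings. The fundamental groupoid $\Pi(K)$ of a simplicial set $K$ is the groupoid generated by the vertices and $1$-simplices of $K$ with the relations that $s_0(x)$ is the identity of $x$ for $x\in K_0$, and that $d_2(z)$ followed by $d_0(z)$ equals $d_1(z)$ for $z\in K_2$. Put $\Pi^l(X)=\Pi(\mathscr N^l(X))$; its objects are the vertices of $X$, and (for $l\geq 1$) every $(x',x)\in X_1$ gives a morphism $(x',x):x'\to x$. **Theorem.** Let $l\ge 1$ and let $X$ be a digraph. There are equivalences of categories $${\sf Cov}_l(X)\simeq{\sf Cov}(\mathscr N^l(X))\simeq{\sf Cov}(\Pi^l(X))\simeq{\sf Set}^{\Pi^l(X)^{\sf op}}$$ such that the following holds. 1. The first equivalence is the functor $p\mapsto\mathscr N^l(p)$, the second is $p\mapsto\Pi(p)$,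 and the third sends a covering $p:H\to G=\Pi^l(X)$ to the presheaf $g\mapsto p^{-1}(g)$ on which a morphism $\gamma:g'\to g$ acts by sending $h\in p^{-1}(g)$ to the unique $h'\in p^{-1}(g')$ such that $\gamma$ lifts to a morphism $h'\to h$. 2. Up to natural isomorphism, the composite functor ${\sf Fib}:{\sf Cov}_l(X)\to{\sf Set}^{\Pi^l(X)^{\sf op}}$ is given by ${\sf Fib}(p)(x)=p^{-1}(x)$, and for $(x',x)\in X_1$ the map ${\sf Fib}(p)((x',x)):p^{-1}(x)\to p^{-1}(x')$ sends $e$ to the unique $e'\in p^{-1}(x')$ with $(e',e)\in E_1$, where $p:E\to X$. 3. Up to natural isomorphism, the inverse composite functor $\Psi:{\sf Set}^{\Pi^l(X)^{\sf op}}\to{\sf Cov}_l(X)$ sends $L$ to the $l$-covering $p:E\to X$ with $E_0=\coprod_{x\in X_0}L(x)$, whose arrows are the pairs $(L((x',x))(e),e)$ for an arrow $(x',x)\in A(X)$ and $e\in L(x)$, and where $p$ sends $L(x)$ to $x$. -/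

import Mathlib

open CategoryTheory Opposite

universe u

noncomputable section

/-! ### Digraphs -/

/-- A digraph: a set of vertices and a set of arrows, an arrow being an ordered pair of
distinct vertices. -/
structure Digr : Type (u + 1) where
  /-- the vertices -/
  V : Type u
  /-- the arrows -/
  graph : Digraph V
  loopless : ∀ x, ¬ graph.Adj x x

namespace Digr

/-- `X.E₁ x y` means that `(x, y)` belongs to the union `X₁` of the set of arrows and the
diagonal. -/
def E₁ (X : Digr.{u}) (x y : X.V) : Prop := x = y ∨ X.graph.Adj x y

/-- A morphism of digraphs is a map on vertices that preserves `X₁`. -/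
@[ext]
structure Hom (X Y : Digr.{u}) : Type u where
  toFun : X.V → Y.V
  map_E₁ : ∀ ⦃x y⦄, X.E₁ x y → Y.E₁ (toFun x) (toFun y)

instance : Category.{u} Digr.{u} where
  Hom := Hom
  id X := ⟨id, fun _ _ h => h⟩
  comp f g := ⟨g.toFun ∘ f.toFun, fun _ _ h => g.map_E₁ (f.map_E₁ h)⟩

@[ext]
lemma hom_ext {X Y : Digr.{u}} {f g : X ⟶ Y} (h : f.toFun = g.toFun) : f = g := Hom.ext h

@[simp] lemma id_toFun (X : Digr.{u}) : Hom.toFun (𝟙 X) = id := rfl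

@[simp] lemma comp_toFun {X Y Z : Digr.{u}} (f : X ⟶ Y) (g : Y ⟶ Z) :
    (f ≫ g).toFun = g.toFun ∘ f.toFun := rfl

/-- `X.HasPath n x y`: there is an `n`-path `(x₀, …, xₙ)` with `x₀ = x`, `xₙ = y` and
`(xᵢ, xᵢ₊₁) ∈ X₁` for all `i`. -/
inductive HasPath (X : Digr.{u}) : ℕ → X.V → X.V → Prop
  | nil {x : X.V} : HasPath X 0 x x
  | snoc {n : ℕ} {x y z : X.V} : HasPath X n x y → X.E₁ y z → HasPath X (n + 1) x z

/-- The minimal length of a path from `x` to `y`, and `⊤` if there is none. -/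
def dist (X : Digr.{u}) (x y : X.V) : ℕ∞ := ⨅ (n : ℕ) (_ : X.HasPath n x y), (n : ℕ∞)

section dist

variable {X Y : Digr.{u}}

lemma HasPath.append {m n : ℕ} {x y z : X.V} (h : X.HasPath m x y) (h' : X.HasPath n y z) :
    X.HasPath (m + n) x z := by
  induction h' with
  | nil => exact h
  | snoc _ e ih => exact (ih h).snoc e

lemma HasPath.dist_le {n : ℕ} {x y : X.V} (h : X.HasPath n x y) : X.dist x y ≤ n :=
  iInf₂_le n h

lemma exists_hasPath_of_dist_ne_top {x y : X.V} (h : X.dist x y ≠ ⊤) :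
    ∃ n : ℕ, X.HasPath n x y ∧ X.dist x y = n := by
  have hne : ∃ n, X.HasPath n x y := by
    by_contra hc
    push Not at hc
    exact h (by simp [dist, hc])
  classical
  refine ⟨Nat.find hne, Nat.find_spec hne, le_antisymm (Nat.find_spec hne).dist_le ?_⟩
  exact le_iInf₂ fun n hn => by exact_mod_cast Nat.find_min' hne hn

@[simp] lemma dist_self (x : X.V) : X.dist x x = 0 :=
  le_antisymm (by simpa using (HasPath.nil (X := X) (x := x)).dist_le) bot_le

lemma dist_triangle (x y z : X.V) : X.dist x z ≤ X.dist x y + X.dist y z := by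
  by_cases h : X.dist x y = ⊤
  · simp [h]
  by_cases h' : X.dist y z = ⊤
  · simp [h']
  obtain ⟨m, hm, hm'⟩ := exists_hasPath_of_dist_ne_top h
  obtain ⟨n, hn, hn'⟩ := exists_hasPath_of_dist_ne_top h'
  rw [hm', hn']
  exact_mod_cast (hm.append hn).dist_le

lemma HasPath.map (f : X ⟶ Y) {n : ℕ} {x y : X.V} (h : X.HasPath n x y) :
    Y.HasPath n (f.toFun x) (f.toFun y) := by
  induction h with
  | nil => exact .nil
  | snoc _ e ih => exact ih.snoc (f.map_E₁ e)

lemma dist_map_le (f : X ⟶ Y) (x y : X.V) : Y.dist (f.toFun x) (f.toFun y) ≤ X.dist x y :=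
  le_iInf₂ fun _ hn => (hn.map f).dist_le

lemma E₁.dist_le {x y : X.V} (h : X.E₁ x y) : X.dist x y ≤ 1 := by
  simpa using (HasPath.nil.snoc h).dist_le

end dist

/-! ### `l`-coverings of digraphs -/

/-- The digraph `Dₙ(X)` on the vertices of `X` with
`Dₙ(X)₁ = {(x, y) | dist x y ≤ n}`; functorial in `X`. -/
def D (n : ℕ) : Digr.{u} ⥤ Digr.{u} where
  obj X :=
    { V := X.V
      graph := ⟨fun x y => x ≠ y ∧ X.dist x y ≤ n⟩
      loopless := fun _ h => h.1 rfl }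
  map {X Y} f :=
    { toFun := f.toFun
      map_E₁ := by
        rintro x y (rfl | h)
        · exact Or.inl rfl
        · by_cases hxy : f.toFun x = f.toFun y
          · exact Or.inl hxy
          · exact Or.inr ⟨hxy, (dist_map_le f x y).trans h.2⟩ }

/-- A morphism of digraphs is a `1`-covering if the induced morphism of quivers is a covering:
every element of `X₁` lifts uniquely once a lift of its tail, or of its head, is given. -/
def IsOneCovering {E X : Digr.{u}} (p : E ⟶ X) : Prop :=
  (∀ (e : E.V) (x : X.V), X.E₁ (p.toFun e) x → ∃! e' : E.V, E.E₁ e e' ∧ p.toFun e' = x) ∧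
  (∀ (e : E.V) (x : X.V), X.E₁ x (p.toFun e) → ∃! e' : E.V, E.E₁ e' e ∧ p.toFun e' = x)

/-- A morphism of digraphs is an `l`-covering if `Dₙ(p)` is a `1`-covering for `1 ≤ n ≤ l`. -/
def lCovering (l : ℕ) : MorphismProperty Digr.{u} :=
  fun _ _ p => ∀ n : ℕ, 1 ≤ n → n ≤ l → IsOneCovering ((D n).map p)

/-- The category of `l`-coverings of `X`, a full subcategory of the category of digraphs
over `X`. -/
abbrev Cov (l : ℕ) (X : Digr.{u}) : Type (u + 1) :=
  ((lCovering l).overObj (X := X)).FullSubcategory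

/-! ### The filtered nerve -/

/-- A sequence of vertices is accessible if consecutive distances are finite. -/
def IsAccessible (X : Digr.{u}) {n : ℕ} (x : Fin (n + 1) → X.V) : Prop :=
  ∀ i : Fin n, X.dist (x i.castSucc) (x i.succ) < ⊤

/-- The length of a sequence of vertices. -/
def length (X : Digr.{u}) {n : ℕ} (x : Fin (n + 1) → X.V) : ℕ∞ :=
  ∑ i : Fin n, X.dist (x i.castSucc) (x i.succ)

section length

variable {X Y : Digr.{u}}

lemma isAccessible_of_length_le {n l : ℕ} {x : Fin (n + 1) → X.V} (h : X.length x ≤ l) :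
    X.IsAccessible x := fun i =>
  lt_of_le_of_lt ((Finset.single_le_sum (f := fun i : Fin n => X.dist (x i.castSucc) (x i.succ))
    (fun _ _ => bot_le) (Finset.mem_univ i)).trans h) (ENat.natCast_lt_top l)

lemma length_map_le (f : X ⟶ Y) {n : ℕ} (x : Fin (n + 1) → X.V) :
    Y.length (f.toFun ∘ x) ≤ X.length x :=
  Finset.sum_le_sum fun _ _ => dist_map_le f _ _

/-- Partial sums of the length bound the distances. -/
lemma sum_add_dist_le (y : ℕ → X.V) (a b : ℕ) (h : a ≤ b) :
    ∑ i ∈ Finset.range a, X.dist (y i) (y (i + 1)) + X.dist (y a) (y b) ≤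
      ∑ i ∈ Finset.range b, X.dist (y i) (y (i + 1)) := by
  induction b, h using Nat.le_induction with
  | base => simp
  | succ b _ ih =>
    rw [Finset.sum_range_succ _ b]
    refine le_trans ?_ (add_le_add_left ih _)
    rw [add_assoc]
    exact add_le_add_right (dist_triangle _ _ _) _

lemma length_comp_le {m n : ℕ} (x : Fin (n + 1) → X.V) (f : Fin (m + 1) →o Fin (n + 1)) :
    X.length (x ∘ f) ≤ X.length x := by
  have hx : ∃ y : ℕ → X.V, ∀ i : Fin (n + 1), y i = x i :=
    ⟨fun i => x ⟨min i n, by omega⟩, fun i => congrArg x (Fin.ext (min_eq_left (by omega)))⟩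
  obtain ⟨y, hy⟩ := hx
  have hg : ∃ g : ℕ → ℕ, Monotone g ∧ ∀ i : Fin (m + 1), g i = f i := by
    refine ⟨fun i => f ⟨min i m, by omega⟩, fun i j hij => ?_, fun i => ?_⟩
    · exact f.monotone (by simp only [Fin.mk_le_mk]; omega)
    · exact congrArg (fun j => (f j : ℕ)) (Fin.ext (min_eq_left (by omega)))
  obtain ⟨g, hgm, hg⟩ := hg
  have h1 : X.length x = ∑ i ∈ Finset.range n, X.dist (y i) (y (i + 1)) := by
    rw [Finset.sum_range]
    refine Finset.sum_congr rfl fun i _ => ?_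
    rw [← hy, ← hy]; simp
  have h2 : X.length (x ∘ f) = ∑ i ∈ Finset.range m, X.dist (y (g i)) (y (g (i + 1))) := by
    rw [Finset.sum_range]
    refine Finset.sum_congr rfl fun i _ => ?_
    simp only [Function.comp]
    rw [← hy, ← hy, ← hg, ← hg]; simp
  have h3 : ∀ k, ∑ i ∈ Finset.range k, X.dist (y (g i)) (y (g (i + 1))) ≤
      ∑ i ∈ Finset.range (g k), X.dist (y i) (y (i + 1)) := by
    intro k
    induction k with
    | zero => simp
    | succ k ih =>
      rw [Finset.sum_range_succ]
      exact (add_le_add_left ih _).trans (sum_add_dist_le y _ _ (hgm k.le_succ))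
  rw [h1, h2]
  refine (h3 m).trans (Finset.sum_le_sum_of_subset ?_)
  have := hg (Fin.last m)
  have h4 := (f (Fin.last m)).isLt
  simp only [Fin.val_last] at this
  exact Finset.range_mono (by omega)

end length

/-- The simplicial set `𝒩ˡ(X)`: its `n`-simplices are the accessible sequences
`(x₀, …, xₙ)` of vertices of length at most `l`, and a monotone map acts by
reindexing. -/
def nerveObj (l : ℕ) (X : Digr.{u}) : SSet.{u} where
  obj n := {x : Fin (n.unop.len + 1) → X.V // X.IsAccessible x ∧ X.length x ≤ l}
  map f := ↾fun x =>
    have h := (length_comp_le x.1 f.unop.toOrderHom).trans x.2.2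
    ⟨x.1 ∘ f.unop.toOrderHom, isAccessible_of_length_le h, h⟩

/-- The `l`-th term of the filtered nerve, as a functor. -/
def nerve (l : ℕ) : Digr.{u} ⥤ SSet.{u} where
  obj X := nerveObj l X
  map f :=
    { app := fun n => ↾fun x =>
        have h := (length_map_le f x.1).trans x.2.2
        ⟨f.toFun ∘ x.1, isAccessible_of_length_le h, h⟩ }

end Digr

/-! ### Coverings of simplicial sets and their fundamental groupoids -/

namespace SSet

section

open Simplicial

/-- A morphism of simplicial sets is a covering if it has the unique lifting property with
respect to all the inclusions `i_k : Δ[0] ⟶ Δ[m]` of a vertex. -/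
def covering : MorphismProperty SSet.{u} := fun E K p =>
  ∀ (m : ℕ) (k : Fin (m + 1)) (s : Δ[0] ⟶ E) (t : Δ[m] ⟶ K),
    s ≫ p = SSet.stdSimplex.map (SimplexCategory.const ⦋0⦌ ⦋m⦌ k) ≫ t →
      ∃! r : Δ[m] ⟶ E,
        SSet.stdSimplex.map (SimplexCategory.const ⦋0⦌ ⦋m⦌ k) ≫ r = s ∧ r ≫ p = t

/-- The category of coverings of a simplicial set. -/
abbrev Cov (K : SSet.{u}) : Type (u + 1) := ((covering.{u}).overObj (X := K)).FullSubcategory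

/-- The vertices of a simplicial set `K`, as the vertices of the quiver whose arrows are the
`1`-simplices of `K`. -/
def EdgeQuiver (K : SSet.{u}) : Type u := K _⦋0⦌

instance (K : SSet.{u}) : Quiver.{u} (EdgeQuiver K) where
  Hom x y := SSet.Edge (X := K) x y

/-- The morphism in the free groupoid given by a `1`-simplex. -/
abbrev freeEdge {K : SSet.{u}} {x y : K _⦋0⦌} (e : Edge x y) :
    (Quiver.FreeGroupoid.of (EdgeQuiver K)).obj x ⟶ (Quiver.FreeGroupoid.of (EdgeQuiver K)).obj y :=
  (Quiver.FreeGroupoid.of (EdgeQuiver K)).map (X := x) (Y := y) e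

end

/-- The defining relations of the fundamental groupoid: degenerate `1`-simplices are identities,
and `d₂ z ≫ d₀ z = d₁ z` for every `2`-simplex `z`. -/
inductive piRel (K : SSet.{u}) : HomRel (Quiver.FreeGroupoid (EdgeQuiver K))
  | id (x : K.obj (op (SimplexCategory.mk 0))) : piRel K (freeEdge (Edge.id x)) (𝟙 _)
  | comp {x₀ x₁ x₂ : K.obj (op (SimplexCategory.mk 0))} {e₀₁ : Edge x₀ x₁} {e₁₂ : Edge x₁ x₂} {e₀₂ : Edge x₀ x₂}
      (z : Edge.CompStruct e₀₁ e₁₂ e₀₂) :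
      piRel K (freeEdge e₀₁ ≫ freeEdge e₁₂) (freeEdge e₀₂)

section

open Simplicial

/-- The map on quivers of `1`-simplices induced by a morphism of simplicial sets. -/
def edgeMap {K L : SSet.{u}} (f : K ⟶ L) : EdgeQuiver K ⥤q EdgeQuiver L where
  obj x := f.app (op ⦋0⦌) x
  map e := Edge.map e f

lemma freeGroupoidFunctor_freeEdge {K L : SSet.{u}} (f : K ⟶ L) {x y : K _⦋0⦌} (e : Edge x y) :
    (Quiver.freeGroupoidFunctor (edgeMap f)).map (freeEdge e) = freeEdge (e.map f) := by
  have := Prefunctor.congr_hom (Quiver.FreeGroupoid.lift_spec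
    (edgeMap f ⋙q Quiver.FreeGroupoid.of (EdgeQuiver L))) (X := x) (Y := y) e
  exact this

/-- The functor of fundamental groupoids induced by a morphism of simplicial sets. -/
def fundGrpdMap {K L : SSet.{u}} (f : K ⟶ L) :
    CategoryTheory.Quotient (piRel K) ⥤ CategoryTheory.Quotient (piRel L) :=
  CategoryTheory.Quotient.lift (piRel K)
    (Quiver.freeGroupoidFunctor (edgeMap f) ⋙ CategoryTheory.Quotient.functor (piRel L)) (by
      rintro _ _ _ _ (x | z)
      · change (CategoryTheory.Quotient.functor (piRel L)).map
            ((Quiver.freeGroupoidFunctor (edgeMap f)).map (freeEdge (Edge.id x))) =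
          (CategoryTheory.Quotient.functor (piRel L)).map
            ((Quiver.freeGroupoidFunctor (edgeMap f)).map (𝟙 _))
        rw [freeGroupoidFunctor_freeEdge, CategoryTheory.Functor.map_id, SSet.Edge.map_id]
        exact CategoryTheory.Quotient.sound _ (piRel.id _)
      · rename_i e₀₁ e₁₂ e₀₂
        change (CategoryTheory.Quotient.functor (piRel L)).map
            ((Quiver.freeGroupoidFunctor (edgeMap f)).map (freeEdge e₀₁ ≫ freeEdge e₁₂)) =
          (CategoryTheory.Quotient.functor (piRel L)).map
            ((Quiver.freeGroupoidFunctor (edgeMap f)).map (freeEdge e₀₂))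
        rw [Functor.map_comp, freeGroupoidFunctor_freeEdge, freeGroupoidFunctor_freeEdge,
          freeGroupoidFunctor_freeEdge]
        exact CategoryTheory.Quotient.sound _ (piRel.comp (z.map f)))

/-- The fundamental groupoid `Π` of simplicial sets, as a functor: `Π(K)` is the groupoid
defined by the quiver of `1`-simplices of `K` with the relations `piRel K`. -/
def fundGrpd : SSet.{u} ⥤ Grpd.{u, u} where
  obj K := Grpd.of (CategoryTheory.Quotient (piRel K))
  map f := fundGrpdMap f
  map_id K := by
    symm
    apply CategoryTheory.Quotient.lift_unique
    have h : edgeMap (𝟙 K) = 𝟭q (EdgeQuiver K) := rfl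
    rw [h, Quiver.freeGroupoidFunctor_id]
    rfl
  map_comp {K L M} f g := by
    symm
    apply CategoryTheory.Quotient.lift_unique
    have h : edgeMap (f ≫ g) = edgeMap f ⋙q edgeMap g := rfl
    rw [h, Quiver.freeGroupoidFunctor_comp]
    rfl

/-- The object of the fundamental groupoid given by a vertex. -/
def fundGrpd.vertex (K : SSet.{u}) (x : K _⦋0⦌) : fundGrpd.obj K :=
  (CategoryTheory.Quotient.functor (piRel K)).obj ((Quiver.FreeGroupoid.of (EdgeQuiver K)).obj x)

/-- The morphism of the fundamental groupoid given by a `1`-simplex. -/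
def fundGrpd.edge {K : SSet.{u}} {x y : K _⦋0⦌} (e : Edge x y) :
    fundGrpd.vertex K x ⟶ fundGrpd.vertex K y :=
  (CategoryTheory.Quotient.functor (piRel K)).map (freeEdge e)

end

end SSet

/-! ### Coverings of groupoids and presheaves -/

namespace CategoryTheory.Grpd

/-- A morphism of groupoids is a covering if it is a covering of the underlying quivers. -/
def covering : MorphismProperty Grpd.{u, u} := fun H G p =>
  (Functor.toPrefunctor (C := H) (D := G) p).IsCovering

/-- The category of coverings of a groupoid. -/
abbrev Cov (G : Grpd.{u, u}) : Type (u + 1) := ((covering.{u}).overObj (X := G)).FullSubcategory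

variable {G : Grpd.{u, u}}

/-- The covering functor. -/
def Cov.proj (p : Cov G) : p.obj.left ⥤ G := p.obj.hom

/-- The fibre of a covering over an object. -/
def Cov.Fibre (p : Cov G) (g : G) : Type u := {h : p.obj.left // p.proj.obj h = g}

/-- `p.IsTransport γ h h'` says that the morphism `γ : g' ⟶ g` lifts to a morphism
from the point `h'` of the fibre over `g'` to the point `h` of the fibre over `g`. -/
def Cov.IsTransport (p : Cov G) {g' g : G} (γ : g' ⟶ g) (h : p.Fibre g) (h' : p.Fibre g') : Prop :=
  ∃ φ : h'.1 ⟶ h.1, p.proj.IsHomLift γ φ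

lemma Cov.existsUnique_isTransport (p : Cov G) {g' g : G} (γ : g' ⟶ g) (h : p.Fibre g) :
    ∃! h' : p.Fibre g', p.IsTransport γ h h' := by
  obtain ⟨h, rfl⟩ := h
  have hp : p.proj.toPrefunctor.IsCovering := p.property
  obtain ⟨⟨h', φ⟩, hφ⟩ := (hp.costar_bijective h).2 ⟨g', γ⟩
  have h1 : p.proj.obj h' = g' := congrArg Sigma.fst hφ
  subst h1
  have h2 : p.proj.map φ = γ := eq_of_heq (Sigma.mk.inj hφ).2
  subst h2
  refine ⟨⟨h', rfl⟩, ⟨φ, inferInstance⟩, ?_⟩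
  rintro ⟨k, hk⟩ ⟨ψ, hψ⟩
  have key : (⟨k, ψ⟩ : Quiver.Costar h) = ⟨h', φ⟩ := by
    apply (hp.costar_bijective h).1
    refine Sigma.ext hk ?_
    have := IsHomLift.fac' p.proj (p.proj.map φ) ψ
    change HEq (p.proj.map ψ) (p.proj.map φ)
    rw [this]
    simp
  exact Subtype.ext (congrArg Sigma.fst key)

/-- The transport along `γ` between fibres, given by unique lifting. -/
def Cov.transport (p : Cov G) {g' g : G} (γ : g' ⟶ g) (h : p.Fibre g) : p.Fibre g' :=
  (p.existsUnique_isTransport γ h).choose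

lemma Cov.isTransport_transport (p : Cov G) {g' g : G} (γ : g' ⟶ g) (h : p.Fibre g) :
    p.IsTransport γ h (p.transport γ h) :=
  (p.existsUnique_isTransport γ h).choose_spec.1

lemma Cov.IsTransport.eq {p : Cov G} {g' g : G} {γ : g' ⟶ g} {h : p.Fibre g} {h' : p.Fibre g'}
    (H : p.IsTransport γ h h') : p.transport γ h = h' :=
  (p.existsUnique_isTransport γ h).unique (p.isTransport_transport γ h) H

/-- The presheaf of fibres of a covering of groupoids. -/
def Cov.presheaf (p : Cov G) : Gᵒᵖ ⥤ Type u where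
  obj g := p.Fibre g.unop
  map γ := ↾fun h => p.transport γ.unop h
  map_id g := by
    ext h
    exact Cov.IsTransport.eq ⟨𝟙 _, IsHomLift.id h.2⟩
  map_comp γ δ := by
    ext h
    obtain ⟨φ, hφ⟩ := p.isTransport_transport γ.unop h
    obtain ⟨ψ, hψ⟩ := p.isTransport_transport δ.unop (p.transport γ.unop h)
    exact Cov.IsTransport.eq
      ⟨ψ ≫ φ, inferInstanceAs (p.proj.IsHomLift (δ.unop ≫ γ.unop) (ψ ≫ φ))⟩

/-- The functor underlying a morphism of coverings. -/
def Cov.homFunctor {p q : Cov G} (f : p ⟶ q) : p.obj.left ⥤ q.obj.left := f.hom.left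

lemma Cov.homFunctor_comp_proj {p q : Cov G} (f : p ⟶ q) :
    Cov.homFunctor f ⋙ q.proj = p.proj := Over.w f.hom

/-- The map on fibres induced by a morphism of coverings. -/
def Cov.mapFibre {p q : Cov G} (f : p ⟶ q) {g : G} (h : p.Fibre g) : q.Fibre g :=
  ⟨(Cov.homFunctor f).obj h.1, (Functor.congr_obj (Cov.homFunctor_comp_proj f) h.1).trans h.2⟩

lemma isHomLift_map_of_comp_eq {A B C : Type*} [Category* A] [Category* B] [Category* C]
    {F : A ⥤ B} {q : B ⥤ C} {p : A ⥤ C} (hF : F ⋙ q = p) {x y : C} {a b : A} (γ : x ⟶ y)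
    (φ : a ⟶ b) (hφ : p.IsHomLift γ φ) : q.IsHomLift γ (F.map φ) := by
  subst hF
  obtain ⟨⟩ := hφ
  exact IsHomLift.map q (F.map φ)

lemma Cov.mapFibre_transport {p q : Cov G} (f : p ⟶ q) {g' g : G} (γ : g' ⟶ g) (h : p.Fibre g) :
    q.transport γ (Cov.mapFibre f h) = Cov.mapFibre f (p.transport γ h) := by
  obtain ⟨φ, hφ⟩ := p.isTransport_transport γ h
  exact Cov.IsTransport.eq ⟨(Cov.homFunctor f).map φ,
    isHomLift_map_of_comp_eq (Cov.homFunctor_comp_proj f) γ φ hφ⟩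

variable (G) in
/-- The functor from coverings of a groupoid `G` to presheaves on `G` that sends a covering to
its fibres with transport by unique lifting. -/
def fibreFunctor : Cov G ⥤ (Gᵒᵖ ⥤ Type u) where
  obj p := p.presheaf
  map f :=
    { app := fun _ => ↾fun h => Cov.mapFibre f h
      naturality := fun _ _ γ => by
        ext h
        exact (Cov.mapFibre_transport f γ.unop h).symm }

end CategoryTheory.Grpd

/-! ### The `l`-fundamental groupoid, fibres, and the covering defined by a presheaf -/

namespace Digr

/-- The `l`-fundamental groupoid `Πˡ(X) = Π(𝒩ˡ(X))`. -/
abbrev fundGrpd (l : ℕ) (X : Digr.{u}) : Grpd.{u, u} := SSet.fundGrpd.obj ((nerve l).obj X)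

section

variable {l : ℕ} {X : Digr.{u}}

/-- A vertex `x` as a `0`-simplex of `𝒩ˡ(X)`. -/
def vertexSimplex (l : ℕ) {X : Digr.{u}} (x : X.V) :
    ((nerve l).obj X).obj (op (SimplexCategory.mk 0)) :=
  ⟨fun _ => x, isAccessible_of_length_le (l := l) (by simp [length]), by simp [length]⟩

/-- A pair `(x, y) ∈ X₁` as a `1`-simplex of `𝒩ˡ(X)`, where `l ≥ 1`. -/
def edgeSimplex (hl : 1 ≤ l) {x y : X.V} (h : X.E₁ x y) :
    SSet.Edge (vertexSimplex l x) (vertexSimplex l y) :=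
  have hlen : X.length ![x, y] ≤ l := by
    simpa [length] using h.dist_le.trans (by exact_mod_cast hl)
  SSet.Edge.mk (X := (nerve l).obj X) ⟨![x, y], isAccessible_of_length_le hlen, hlen⟩
    (by
      refine Subtype.ext (funext fun i => ?_)
      fin_cases i
      rfl)
    (by
      refine Subtype.ext (funext fun i => ?_)
      fin_cases i
      rfl)

/-- A vertex of `X` as an object of `Πˡ(X)`. -/
def vertex (l : ℕ) {X : Digr.{u}} (x : X.V) : X.fundGrpd l :=
  SSet.fundGrpd.vertex _ (vertexSimplex l x)

/-- A pair `(x, y) ∈ X₁` as a morphism of `Πˡ(X)`, where `l ≥ 1`. -/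
def arrow (hl : 1 ≤ l) {x y : X.V} (h : X.E₁ x y) : vertex l x ⟶ vertex l y :=
  SSet.fundGrpd.edge (edgeSimplex hl h)

end

/-- The fibre functor `(p : E ⟶ X) ↦ p⁻¹(x)`. -/
def fibre {X : Digr.{u}} (x : X.V) : Over X ⥤ Type u where
  obj p := {e : p.left.V // p.hom.toFun e = x}
  map {p q} f := ↾fun e => ⟨f.left.toFun e.1,
    (congrFun (congrArg Hom.toFun (Over.w f)) e.1).trans e.2⟩

/-- The digraph over `X` defined by a presheaf `L` on `Πˡ(X)`: its set of vertices is
`∐ₓ L(x)`, its arrows are `(L((x', x))(e), e)` for the arrows `(x', x)` of `X` and `e ∈ L(x)`,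
and the projection to `X` sends the elements of `L(x)` to `x`. -/
def total (l : ℕ) (hl : 1 ≤ l) (X : Digr.{u}) : ((X.fundGrpd l)ᵒᵖ ⥤ Type u) ⥤ Over X where
  obj L := Over.mk (Y :=
      { V := Σ x : X.V, L.obj (op (vertex l x))
        graph := ⟨fun e' e => ∃ h : X.graph.Adj e'.1 e.1,
          e'.2 = L.map (arrow hl (Or.inr h)).op e.2⟩
        loopless := fun e h => X.loopless e.1 h.1 })
    { toFun := fun e => e.1
      map_E₁ := by
        rintro e' e (h | h)
        · exact Or.inl (congrArg Sigma.fst h)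
        · exact Or.inr h.1 }
  map {L M} f := Over.homMk
    { toFun := fun e => ⟨e.1, f.app _ e.2⟩
      map_E₁ := by
        rintro e' e (rfl | ⟨h, he⟩)
        · exact Or.inl rfl
        · refine Or.inr ⟨h, ?_⟩
          change f.app _ e'.2 = M.map (arrow hl (Or.inr h)).op (f.app _ e.2)
          rw [he]
          exact NatTrans.naturality_apply f _ _ }

end Digr

end

/-! Each of the three functors is fully faithful, and one explicit construction makes the composite
essentially surjective. Every presheaf `L` on the fundamental groupoid is the presheaf of fibres of
its total digraph (`presheafCovCompIso`). Since fully faithful functors can be cancelled on the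
right of an essentially surjective composite, each functor is an equivalence. The same isomorphism
identifies the inverse of the composite with the total digraph construction.

Four facts carry the argument. The nerve of an `l`-covering is a covering
(`lCovering.covering_nerve_map`): the vertices of a simplex are lifted separately from one given
lift, and the bound `l` on the total length forces the consecutive distances to be right.

The fundamental groupoid preserves coverings (`covering.isCovering_mapFunctor`). Lifts of morphisms
exist by induction on generators. For uniqueness, the base groupoid acts on pairs consisting of a
point of the total space and a path class to it from a fixed base point; this action recovers a
morphism upstairs from its image.

A functor over the base between fundamental groupoids of coverings comes from a simplicial map
(`covering.exists_hom`), because simplices lift uniquely from one vertex and the edges from that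
vertex control the others.

The total digraph of `L` is an `l`-covering (`lCovering_total`): along a path of length at most `l`,
the successive actions of `L` compose to the action of a single morphism that depends only on the
end points. -/

noncomputable section

/-! ### Unique lifting of morphisms along coverings -/

namespace CategoryTheory

section

variable {A B C : Type*} [Category* A] [Category* B] [Category* C]

lemma IsHomLift.ext_of_isCovering {q : B ⥤ C} (hq : q.toPrefunctor.IsCovering) {a b : B}
    {x y : C} (γ : x ⟶ y) (φ ψ : a ⟶ b) [q.IsHomLift γ φ] [q.IsHomLift γ ψ] : φ = ψ := by
  apply hq.map_injective
  change q.map φ = q.map ψ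
  rw [IsHomLift.fac' q γ φ, IsHomLift.fac' q γ ψ]

lemma IsHomLift.star_eq (q : B ⥤ C) {a b : B} {y : C} (γ : q.obj a ⟶ y) (φ : a ⟶ b)
    (h : q.IsHomLift γ φ) : q.toPrefunctor.star a ⟨b, φ⟩ = ⟨y, γ⟩ := by
  obtain rfl := IsHomLift.codomain_eq q γ φ
  obtain rfl := IsHomLift.eq_of_isHomLift q γ φ
  rfl

lemma IsHomLift.costar_eq (q : B ⥤ C) {a b : B} {x : C} (γ : x ⟶ q.obj b) (φ : a ⟶ b)
    (h : q.IsHomLift γ φ) : q.toPrefunctor.costar b ⟨a, φ⟩ = ⟨x, γ⟩ := by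
  obtain rfl := IsHomLift.domain_eq q γ φ
  obtain rfl := IsHomLift.eq_of_isHomLift q γ φ
  rfl

lemma IsHomLift.codomain_unique {q : B ⥤ C} (hq : q.toPrefunctor.IsCovering) {a b b' : B}
    {x y : C} (γ : x ⟶ y) (φ : a ⟶ b) (ψ : a ⟶ b') (hφ : q.IsHomLift γ φ)
    (hψ : q.IsHomLift γ ψ) : b = b' := by
  obtain rfl := IsHomLift.domain_eq q γ φ
  exact congrArg Sigma.fst ((hq.star_bijective a).1
    ((IsHomLift.star_eq q γ φ hφ).trans (IsHomLift.star_eq q γ ψ hψ).symm))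

/-- Functors into the source of a covering that agree on objects and after projection are equal. -/
lemma Functor.ext_of_isCovering {q : B ⥤ C} (hq : q.toPrefunctor.IsCovering) {F F' : A ⥤ B}
    (h : F ⋙ q = F' ⋙ q) (hobj : ∀ a, F.obj a = F'.obj a) : F = F' := by
  refine Functor.ext hobj fun a b f => ?_
  apply hq.map_injective
  have := Functor.congr_hom h f
  change q.map (F.map f) = q.map _
  simpa [eqToHom_map] using this

end

/-! ### Full faithfulness of the fibre functor on coverings of a groupoid -/

namespace Grpd

variable {G : Grpd.{u, u}}

lemma Cov.isCovering (p : Cov G) : p.proj.toPrefunctor.IsCovering := p.property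

lemma Cov.hom_ext_obj {p q : Cov G} {f g : p ⟶ q}
    (h : ∀ a, (Cov.homFunctor f).obj a = (Cov.homFunctor g).obj a) : f = g := by
  apply ObjectProperty.hom_ext
  apply Over.OverMorphism.ext
  exact Functor.ext_of_isCovering q.isCovering
    ((Cov.homFunctor_comp_proj f).trans (Cov.homFunctor_comp_proj g).symm) h

instance : (fibreFunctor G).Faithful where
  map_injective {p q f g} h := by
    refine Cov.hom_ext_obj fun a => ?_
    have := types_congr_hom (NatTrans.congr_app h (op (p.proj.obj a))) ⟨a, rfl⟩
    exact congrArg Subtype.val this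

section

variable {p q : Cov G} (η : p.presheaf ⟶ q.presheaf)

/-- The action on objects of the morphism of coverings given by a morphism of fibres. -/
def Cov.objOfPresheafHom (a : p.obj.left) : q.Fibre (p.proj.obj a) :=
  η.app (op (p.proj.obj a)) (⟨a, rfl⟩ : p.Fibre (p.proj.obj a))

/-- The morphism `φ` itself witnesses that its source is the transport of its target; naturality of
`η` carries this over to `q`. -/
lemma Cov.isTransport_objOfPresheafHom {a b : p.obj.left} (φ : a ⟶ b) :
    q.IsTransport (p.proj.map φ) (Cov.objOfPresheafHom η b) (Cov.objOfPresheafHom η a) := by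
  have h : p.transport (p.proj.map φ) ⟨b, rfl⟩ = ⟨a, rfl⟩ :=
    Cov.IsTransport.eq ⟨φ, inferInstance⟩
  have h' : q.transport (p.proj.map φ) (Cov.objOfPresheafHom η b) =
      Cov.objOfPresheafHom η a := by
    have := types_congr_hom (η.naturality (p.proj.map φ).op) (⟨b, rfl⟩ : p.Fibre _)
    refine this.symm.trans ?_
    exact congrArg (fun z => η.app (op (p.proj.obj a)) z) h
  rw [← h']
  exact q.isTransport_transport _ _

/-- The functor over `G` given by a morphism between presheaves of fibres. -/
def Cov.functorOfPresheafHom : p.obj.left ⥤ q.obj.left where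
  obj a := (Cov.objOfPresheafHom η a).1
  map φ := (Cov.isTransport_objOfPresheafHom η φ).choose
  map_id a := by
    have h1 := (Cov.isTransport_objOfPresheafHom η (𝟙 a)).choose_spec
    have h2 : q.proj.IsHomLift (p.proj.map (𝟙 a)) (𝟙 (Cov.objOfPresheafHom η a).1) := by
      rw [p.proj.map_id]
      exact IsHomLift.id (Cov.objOfPresheafHom η a).2
    exact IsHomLift.ext_of_isCovering q.isCovering (p.proj.map (𝟙 a)) _ _
  map_comp φ ψ := by
    have h1 := (Cov.isTransport_objOfPresheafHom η φ).choose_spec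
    have h2 := (Cov.isTransport_objOfPresheafHom η ψ).choose_spec
    have h3 := (Cov.isTransport_objOfPresheafHom η (φ ≫ ψ)).choose_spec
    have h4 : q.proj.IsHomLift (p.proj.map (φ ≫ ψ))
        ((Cov.isTransport_objOfPresheafHom η φ).choose ≫
          (Cov.isTransport_objOfPresheafHom η ψ).choose) := by
      rw [p.proj.map_comp]
      infer_instance
    exact IsHomLift.ext_of_isCovering q.isCovering (p.proj.map (φ ≫ ψ)) _ _

lemma Cov.functorOfPresheafHom_comp_proj : Cov.functorOfPresheafHom η ⋙ q.proj = p.proj := by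
  refine Functor.ext (fun a => (Cov.objOfPresheafHom η a).2) fun a b φ => ?_
  have h := (Cov.isTransport_objOfPresheafHom η φ).choose_spec
  exact IsHomLift.fac' q.proj (p.proj.map φ) (Cov.isTransport_objOfPresheafHom η φ).choose

end

instance : (fibreFunctor G).Full where
  map_surjective {p q} η := by
    refine ⟨ObjectProperty.homMk (Over.homMk (U := p.obj) (V := q.obj)
      (Cov.functorOfPresheafHom η) (Cov.functorOfPresheafHom_comp_proj η)), ?_⟩
    refine NatTrans.ext (funext fun g => ?_)
    obtain ⟨g⟩ := g
    refine ConcreteCategory.hom_ext _ _ fun (h : p.Fibre g) => ?_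
    obtain ⟨h, rfl⟩ := h
    rfl

end Grpd

end CategoryTheory

namespace SSet

open Simplicial

/-! ### Generators of the fundamental groupoid -/

namespace fundGrpd

variable {K L : SSet.{u}}

lemma edge_id (x : K _⦋0⦌) : edge (Edge.id x) = 𝟙 (vertex K x) :=
  CategoryTheory.Quotient.sound _ (piRel.id x)

lemma edge_comp {x₀ x₁ x₂ : K _⦋0⦌} {e₀₁ : Edge x₀ x₁} {e₁₂ : Edge x₁ x₂} {e₀₂ : Edge x₀ x₂}
    (z : Edge.CompStruct e₀₁ e₁₂ e₀₂) : edge e₀₁ ≫ edge e₁₂ = edge e₀₂ :=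
  CategoryTheory.Quotient.sound _ (piRel.comp z)

/-- A property of morphisms of the fundamental groupoid that holds for the `1`-simplices and is
stable under composition and inversion holds for all morphisms. -/
theorem hom_induction {P : ∀ {a b : fundGrpd.obj K}, (a ⟶ b) → Prop}
    (h_edge : ∀ {x y : K _⦋0⦌} (e : Edge x y), P (edge e))
    (h_comp : ∀ {a b c : fundGrpd.obj K} (f : a ⟶ b) (g : b ⟶ c), P f → P g → P (f ≫ g))
    (h_inv : ∀ {a b : fundGrpd.obj K} (f : a ⟶ b), P f → P (Groupoid.inv f))
    {a b : fundGrpd.obj K} (f : a ⟶ b) : P f := by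
  have h_one (x : K _⦋0⦌) : P (𝟙 (vertex K x)) := edge_id x ▸ h_edge (Edge.id x)
  -- A morphism is a zigzag of edges modulo two successive quotients, cancellation of inverses and
  -- then `piRel`; hence the nested `Quot.mk`.
  have key {x y : Quiver.Symmetrify (EdgeQuiver K)} (p : Quiver.Path x y) :
      P (a := vertex K x) (b := vertex K y) (Quot.mk _ (Quot.mk _ p)) := by
    induction p with
    | nil => exact h_one x
    | @cons y z p e ih =>
      refine h_comp (a := vertex K x) (b := vertex K y) (c := vertex K z)
        (Quot.mk _ (Quot.mk _ p)) (Quot.mk _ (Quot.mk _ (Quiver.Hom.toPath e))) ih ?_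
      obtain e | e := e
      · exact h_edge (x := y) (y := z) e
      · exact h_inv _ (h_edge (x := z) (y := y) e)
  obtain ⟨⟨p⟩⟩ := f
  exact key p

/-- The functor between fundamental groupoids induced by a morphism of simplicial sets. -/
def mapFunctor (f : K ⟶ L) : fundGrpd.obj K ⥤ fundGrpd.obj L := SSet.fundGrpd.map f

lemma mapFunctor_edge (f : K ⟶ L) {x y : K _⦋0⦌} (e : Edge x y) :
    (mapFunctor f).map (edge e) = edge (e.map f) :=
  congrArg (CategoryTheory.Quotient.functor (piRel L)).map (freeGroupoidFunctor_freeEdge f e)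

/-- The universal property of the fundamental groupoid. -/
def lift {C : Type*} [Groupoid C] (φ : EdgeQuiver K ⥤q C)
    (h_id : ∀ x : K _⦋0⦌, φ.map (X := x) (Y := x) (Edge.id x) = 𝟙 (φ.obj x))
    (h_comp : ∀ {x₀ x₁ x₂ : K _⦋0⦌} {e₀₁ : Edge x₀ x₁} {e₁₂ : Edge x₁ x₂} {e₀₂ : Edge x₀ x₂}
      (_ : Edge.CompStruct e₀₁ e₁₂ e₀₂),
      φ.map (X := x₀) (Y := x₁) e₀₁ ≫ φ.map (X := x₁) (Y := x₂) e₁₂ =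
        φ.map (X := x₀) (Y := x₂) e₀₂) : fundGrpd.obj K ⥤ C :=
  CategoryTheory.Quotient.lift (piRel K) (Quiver.FreeGroupoid.lift φ) (by
    have key : ∀ {x y : K _⦋0⦌} (e : Edge x y),
        (Quiver.FreeGroupoid.lift φ).map (freeEdge e) = φ.map (X := x) (Y := y) e := fun e =>
      Prefunctor.congr_hom (Quiver.FreeGroupoid.lift_spec φ) e
    rintro _ _ _ _ (x | z)
    · exact (key _).trans ((h_id x).trans ((Quiver.FreeGroupoid.lift φ).map_id _).symm)
    · rw [Functor.map_comp]
      exact (congrArg₂ _ (key _) (key _)).trans ((h_comp z).trans (key _).symm))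

lemma lift_edge {C : Type*} [Groupoid C] (φ : EdgeQuiver K ⥤q C) (h_id h_comp)
    {x y : K _⦋0⦌} (e : Edge x y) :
    (lift φ h_id h_comp).map (edge e) = φ.map (X := x) (Y := y) e :=
  Prefunctor.congr_hom (Quiver.FreeGroupoid.lift_spec φ) e

end fundGrpd

/-! ### Vertices of simplices and lifting in coverings -/

section

variable {K L : SSet.{u}}

/-- The `k`-th vertex of a simplex. -/
def vtx {m : ℕ} (σ : K _⦋m⦌) (k : Fin (m + 1)) : K _⦋0⦌ :=
  K.map (SimplexCategory.const ⦋0⦌ ⦋m⦌ k).op σ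

lemma app_vtx (f : K ⟶ L) {m : ℕ} (σ : K _⦋m⦌) (k : Fin (m + 1)) :
    f.app _ (vtx σ k) = vtx (f.app _ σ) k :=
  NatTrans.naturality_apply f _ σ

lemma vtx_map {m n : ℕ} (θ : (⦋m⦌ : SimplexCategory) ⟶ ⦋n⦌) (σ : K _⦋n⦌) (k : Fin (m + 1)) :
    vtx (K.map θ.op σ : K _⦋m⦌) k = vtx σ (θ.toOrderHom k) := by
  unfold vtx
  rw [← SimplexCategory.const_comp, op_comp, Functor.map_comp_apply]

@[simp]
lemma vtx_zero (x : K _⦋0⦌) : vtx x 0 = x := by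
  simp [vtx, SimplexCategory.const_eq_id]

lemma δ_one_eq_vtx (σ : K _⦋1⦌) : K.δ 1 σ = vtx σ 0 := by
  rw [SimplicialObject.δ, SimplexCategory.δ_one_eq_const]
  rfl

lemma δ_zero_eq_vtx (σ : K _⦋1⦌) : K.δ 0 σ = vtx σ 1 := by
  rw [SimplicialObject.δ, SimplexCategory.δ_zero_eq_const]
  rfl

lemma Edge.vtx_zero {x y : K _⦋0⦌} (e : Edge x y) : vtx e.edge 0 = x :=
  (δ_one_eq_vtx _).symm.trans e.src_eq

lemma Edge.vtx_one {x y : K _⦋0⦌} (e : Edge x y) : vtx e.edge 1 = y :=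
  (δ_zero_eq_vtx _).symm.trans e.tgt_eq

/-- A morphism is a covering iff simplices lift uniquely once one of their vertices is lifted. -/
lemma covering_iff {p : K ⟶ L} : covering p ↔
    ∀ (m : ℕ) (k : Fin (m + 1)) (e : K _⦋0⦌) (t : L _⦋m⦌), p.app _ e = vtx t k →
      ∃! r : K _⦋m⦌, vtx r k = e ∧ p.app _ r = t := by
  have key {M : SSet.{u}} {m : ℕ} (k : Fin (m + 1)) (r : Δ[m] ⟶ M) :
      yonedaEquiv (SSet.stdSimplex.map (SimplexCategory.const ⦋0⦌ ⦋m⦌ k) ≫ r) =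
        vtx (yonedaEquiv r) k := by
    obtain ⟨r, rfl⟩ := yonedaEquiv.symm.surjective r
    rw [yonedaEquiv_comp, yonedaEquiv_map, yonedaEquiv_symm_app_objEquiv_symm,
      Equiv.apply_symm_apply]
    rfl
  refine forall₂_congr fun m k => ?_
  refine ⟨fun H e t h => ?_, fun H s t h => ?_⟩
  · obtain ⟨r, ⟨h1, h2⟩, h3⟩ := H (yonedaEquiv.symm e) (yonedaEquiv.symm t) (by
      apply yonedaEquiv.injective
      rw [key, Equiv.apply_symm_apply, yonedaEquiv_comp, Equiv.apply_symm_apply, h])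
    refine ⟨yonedaEquiv r, ⟨?_, ?_⟩, fun r' hr' => ?_⟩
    · rw [← key, h1, Equiv.apply_symm_apply]
    · rw [← yonedaEquiv_comp, h2, Equiv.apply_symm_apply]
    · rw [← h3 (yonedaEquiv.symm r') ⟨?_, ?_⟩, Equiv.apply_symm_apply]
      · apply yonedaEquiv.injective
        rw [key, Equiv.apply_symm_apply, Equiv.apply_symm_apply, hr'.1]
      · rw [yonedaEquiv_symm_comp, hr'.2]
  · obtain ⟨r, ⟨h1, h2⟩, h3⟩ := H (yonedaEquiv s) (yonedaEquiv t) (by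
      rw [← key, ← h, yonedaEquiv_comp])
    refine ⟨yonedaEquiv.symm r, ⟨?_, ?_⟩, fun r' hr' => ?_⟩
    · apply yonedaEquiv.injective
      rw [key, Equiv.apply_symm_apply, h1]
    · rw [yonedaEquiv_symm_comp, h2, Equiv.symm_apply_apply]
    · rw [← h3 (yonedaEquiv r') ⟨?_, ?_⟩, Equiv.symm_apply_apply]
      · rw [← key, hr'.1]
      · rw [← yonedaEquiv_comp, hr'.2]

lemma Edge.star_ext {x : EdgeQuiver K} {s t : Quiver.Star x}
    (h : Edge.edge (X := K) s.2 = Edge.edge (X := K) t.2) : s = t := by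
  obtain ⟨a, s⟩ := s
  obtain ⟨b, t⟩ := t
  change Edge (X := K) x a at s
  change Edge (X := K) x b at t
  change s.edge = t.edge at h
  obtain rfl : a = b := by rw [← s.tgt_eq, ← t.tgt_eq, h]
  obtain rfl := Edge.ext h
  rfl

lemma Edge.costar_ext {x : EdgeQuiver K} {s t : Quiver.Costar x}
    (h : Edge.edge (X := K) s.2 = Edge.edge (X := K) t.2) : s = t := by
  obtain ⟨a, s⟩ := s
  obtain ⟨b, t⟩ := t
  change Edge (X := K) a x at s
  change Edge (X := K) b x at t
  change s.edge = t.edge at h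
  obtain rfl : a = b := by rw [← s.src_eq, ← t.src_eq, h]
  obtain rfl := Edge.ext h
  rfl

/-- A covering of simplicial sets restricts to a covering of the quivers of `1`-simplices. -/
lemma covering.edgeMap {p : K ⟶ L} (hp : covering p) : (SSet.edgeMap p).IsCovering := by
  rw [covering_iff] at hp
  refine ⟨fun e => ⟨fun s t h => ?_, fun t => ?_⟩, fun e => ⟨fun s t h => ?_, fun t => ?_⟩⟩
  · have h' : p.app _ (Edge.edge (X := K) s.2) = p.app _ (Edge.edge (X := K) t.2) :=
      congrArg (fun z : Quiver.Star ((SSet.edgeMap p).obj e) =>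
        Edge.edge (X := L) (x₀ := p.app _ e) (x₁ := z.1) z.2) h
    exact Edge.star_ext ((hp 1 0 e _ ((app_vtx p _ _).symm ▸
      congrArg (p.app _) (Edge.vtx_zero (K := K) s.2).symm)).unique
        ⟨Edge.vtx_zero (K := K) s.2, rfl⟩ ⟨Edge.vtx_zero (K := K) t.2, h'.symm⟩)
  · obtain ⟨r, ⟨h1, h2⟩, -⟩ := hp 1 0 e (Edge.edge (X := L) t.2) (Edge.vtx_zero (K := L) t.2).symm
    refine ⟨⟨vtx r 1, Edge.mk r ?_ ?_⟩, Edge.star_ext h2⟩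
    · exact (δ_one_eq_vtx r).trans h1
    · exact δ_zero_eq_vtx r
  · have h' : p.app _ (Edge.edge (X := K) s.2) = p.app _ (Edge.edge (X := K) t.2) :=
      congrArg (fun z : Quiver.Costar ((SSet.edgeMap p).obj e) =>
        Edge.edge (X := L) (x₀ := z.1) (x₁ := p.app _ e) z.2) h
    exact Edge.costar_ext ((hp 1 1 e _ ((app_vtx p _ _).symm ▸
      congrArg (p.app _) (Edge.vtx_one (K := K) s.2).symm)).unique
        ⟨Edge.vtx_one (K := K) s.2, rfl⟩ ⟨Edge.vtx_one (K := K) t.2, h'.symm⟩)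
  · obtain ⟨r, ⟨h1, h2⟩, -⟩ := hp 1 1 e (Edge.edge (X := L) t.2) (Edge.vtx_one (K := L) t.2).symm
    refine ⟨⟨vtx r 0, Edge.mk r ?_ ?_⟩, Edge.costar_ext h2⟩
    · exact δ_one_eq_vtx r
    · exact (δ_zero_eq_vtx r).trans h1

end

variable {E K : SSet.{u}}

lemma covering.exists_edge_of_src {p : E ⟶ K} (hp : covering p) {x y : K _⦋0⦌} (k : Edge x y)
    (a : E _⦋0⦌) (ha : p.app _ a = x) :
    ∃ (b : E _⦋0⦌) (ε : Edge a b), p.app _ b = y ∧ p.app _ ε.edge = k.edge := by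
  subst ha
  obtain ⟨⟨b, ε⟩, h⟩ := (hp.edgeMap.star_bijective a).2 ⟨y, k⟩
  change Edge (X := E) a b at ε
  obtain rfl : p.app _ b = y := congrArg Sigma.fst h
  exact ⟨b, ε, rfl, congrArg Edge.edge (eq_of_heq (Sigma.mk.inj h).2)⟩

lemma covering.exists_edge_of_tgt {p : E ⟶ K} (hp : covering p) {x y : K _⦋0⦌} (k : Edge x y)
    (b : E _⦋0⦌) (hb : p.app _ b = y) :
    ∃ (a : E _⦋0⦌) (ε : Edge a b), p.app _ a = x ∧ p.app _ ε.edge = k.edge := by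
  subst hb
  obtain ⟨⟨a, ε⟩, h⟩ := (hp.edgeMap.costar_bijective b).2 ⟨x, k⟩
  change Edge (X := E) a b at ε
  obtain rfl : p.app _ a = x := congrArg Sigma.fst h
  exact ⟨a, ε, rfl, congrArg Edge.edge (eq_of_heq (Sigma.mk.inj h).2)⟩

lemma covering.eq_of_vtx {p : E ⟶ K} (hp : covering p) {m : ℕ} {r r' : E _⦋m⦌}
    (k : Fin (m + 1)) (hv : vtx r k = vtx r' k) (h : p.app _ r = p.app _ r') : r = r' :=
  (covering_iff.1 hp m k (vtx r' k) (p.app _ r') (app_vtx p r' k)).unique ⟨hv, h⟩ ⟨rfl, rfl⟩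

/-! ### Coverings of simplicial sets induce coverings of fundamental groupoids -/

section

variable (p : E ⟶ K) (e₀ : E _⦋0⦌)

/-- A point of the fibre over `x` with a morphism to it from the base point `e₀`
in the fundamental groupoid of the total space. -/
structure BasedFibre (x : K _⦋0⦌) : Type u where
  pt : E _⦋0⦌
  map_pt : p.app _ pt = x
  path : fundGrpd.vertex E e₀ ⟶ fundGrpd.vertex E pt

variable {p e₀}

/-- Appending a lift of a `1`-simplex of the base. -/
def BasedFibre.IsStep {x y : K _⦋0⦌} (k : Edge x y) (s : BasedFibre p e₀ x)
    (t : BasedFibre p e₀ y) : Prop :=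
  ∃ ε : Edge s.pt t.pt, p.app _ ε.edge = k.edge ∧ t.path = s.path ≫ fundGrpd.edge ε

lemma BasedFibre.existsUnique_isStep (hp : covering p) {x y : K _⦋0⦌} (k : Edge x y)
    (s : BasedFibre p e₀ x) : ∃! t : BasedFibre p e₀ y, BasedFibre.IsStep k s t := by
  obtain ⟨b, ε, hb, hε⟩ := hp.exists_edge_of_src k s.pt s.map_pt
  refine ⟨⟨b, hb, s.path ≫ fundGrpd.edge ε⟩, ⟨ε, hε, rfl⟩, ?_⟩
  rintro ⟨b', hb', φ⟩ ⟨ε', hε', hφ⟩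
  dsimp only at ε' hε' hφ
  have hE : ε'.edge = ε.edge := hp.eq_of_vtx 0 (ε'.vtx_zero.trans ε.vtx_zero.symm)
    (hε'.trans hε.symm)
  obtain rfl : b' = b := by rw [← ε'.tgt_eq, ← ε.tgt_eq, hE]
  obtain rfl := Edge.ext hE
  rw [hφ]

lemma BasedFibre.existsUnique_isStep_symm (hp : covering p) {x y : K _⦋0⦌} (k : Edge x y)
    (t : BasedFibre p e₀ y) : ∃! s : BasedFibre p e₀ x, BasedFibre.IsStep k s t := by
  obtain ⟨a, ε, ha, hε⟩ := hp.exists_edge_of_tgt k t.pt t.map_pt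
  refine ⟨⟨a, ha, t.path ≫ Groupoid.inv (fundGrpd.edge ε)⟩, ⟨ε, hε, by simp⟩, ?_⟩
  rintro ⟨a', ha', φ⟩ ⟨ε', hε', hφ⟩
  dsimp only at ε' hε' hφ
  have hE : ε'.edge = ε.edge := hp.eq_of_vtx 1 (ε'.vtx_one.trans ε.vtx_one.symm)
    (hε'.trans hε.symm)
  obtain rfl : a' = a := by rw [← ε'.src_eq, ← ε.src_eq, hE]
  obtain rfl := Edge.ext hE
  simp [hφ]

/-- The bijection between based fibres over the end points of a `1`-simplex. -/
def BasedFibre.stepEquiv (hp : covering p) {x y : K _⦋0⦌} (k : Edge x y) :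
    BasedFibre p e₀ x ≃ BasedFibre p e₀ y where
  toFun s := (existsUnique_isStep hp k s).choose
  invFun t := (existsUnique_isStep_symm hp k t).choose
  left_inv s := (existsUnique_isStep_symm hp k _).unique
    (existsUnique_isStep_symm hp k _).choose_spec.1 (existsUnique_isStep hp k s).choose_spec.1
  right_inv t := (existsUnique_isStep hp k _).unique
    (existsUnique_isStep hp k _).choose_spec.1 (existsUnique_isStep_symm hp k t).choose_spec.1

lemma BasedFibre.stepEquiv_eq (hp : covering p) {x y : K _⦋0⦌} {k : Edge x y}
    {s : BasedFibre p e₀ x} {t : BasedFibre p e₀ y} (h : BasedFibre.IsStep k s t) :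
    stepEquiv hp k s = t :=
  (existsUnique_isStep hp k s).unique (existsUnique_isStep hp k s).choose_spec.1 h

lemma BasedFibre.stepEquiv_id (hp : covering p) {x : K _⦋0⦌} (s : BasedFibre p e₀ x) :
    stepEquiv hp (Edge.id x) s = s := by
  obtain ⟨a, rfl, φ⟩ := s
  refine stepEquiv_eq hp ⟨Edge.id a, ?_, ?_⟩
  · rw [← Edge.map_id, Edge.map_edge]
  · rw [fundGrpd.edge_id, Category.comp_id]

lemma Edge.CompStruct.vtx_zero {x₀ x₁ x₂ : K _⦋0⦌} {e₀₁ : Edge x₀ x₁}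
    {e₁₂ : Edge x₁ x₂} {e₀₂ : Edge x₀ x₂} (z : Edge.CompStruct e₀₁ e₁₂ e₀₂) :
    vtx z.simplex 0 = x₀ :=
  (vtx_map (SimplexCategory.δ 2) z.simplex 0).symm.trans
    ((congrArg (fun σ : K _⦋1⦌ => vtx σ 0) z.d₂).trans e₀₁.vtx_zero)

/-- Lifting the 2-simplex from its initial vertex lifts all three edges at once, and the lifted
2-simplex is a relation upstairs that identifies the two resulting paths. -/
lemma BasedFibre.stepEquiv_comp (hp : covering p) {x₀ x₁ x₂ : K _⦋0⦌} {e₀₁ : Edge x₀ x₁}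
    {e₁₂ : Edge x₁ x₂} {e₀₂ : Edge x₀ x₂} (z : Edge.CompStruct e₀₁ e₁₂ e₀₂)
    (s : BasedFibre p e₀ x₀) :
    stepEquiv hp e₁₂ (stepEquiv hp e₀₁ s) = stepEquiv hp e₀₂ s := by
  obtain ⟨a, rfl, φ⟩ := s
  obtain ⟨r, ⟨hr, hrz⟩, -⟩ := covering_iff.1 hp 2 0 a z.simplex z.vtx_zero.symm
  obtain ⟨a₀, a₁, a₂, ε₀₁, ε₁₂, ε₀₂, w, rfl⟩ := Edge.CompStruct.exists_of_simplex r
  obtain rfl : a₀ = a := w.vtx_zero.symm.trans hr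
  have h₀₁ : p.app _ ε₀₁.edge = e₀₁.edge := by
    rw [← w.d₂, ← z.d₂, ← hrz]
    exact NatTrans.naturality_apply p _ _
  have h₁₂ : p.app _ ε₁₂.edge = e₁₂.edge := by
    rw [← w.d₀, ← z.d₀, ← hrz]
    exact NatTrans.naturality_apply p _ _
  have h₀₂ : p.app _ ε₀₂.edge = e₀₂.edge := by
    rw [← w.d₁, ← z.d₁, ← hrz]
    exact NatTrans.naturality_apply p _ _
  have h₁ : p.app _ a₁ = x₁ := by
    rw [← ε₀₁.vtx_one, app_vtx, h₀₁, e₀₁.vtx_one]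
  have h₂ : p.app _ a₂ = x₂ := by
    rw [← ε₁₂.vtx_one, app_vtx, h₁₂, e₁₂.vtx_one]
  rw [stepEquiv_eq hp (t := ⟨a₁, h₁, φ ≫ fundGrpd.edge ε₀₁⟩) ⟨ε₀₁, h₀₁, rfl⟩,
    stepEquiv_eq hp (t := ⟨a₂, h₂, (φ ≫ fundGrpd.edge ε₀₁) ≫ fundGrpd.edge ε₁₂⟩)
      ⟨ε₁₂, h₁₂, rfl⟩,
    stepEquiv_eq hp (t := ⟨a₂, h₂, φ ≫ fundGrpd.edge ε₀₂⟩) ⟨ε₀₂, h₀₂, rfl⟩,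
    Category.assoc, fundGrpd.edge_comp w]

/-- The functor of based fibres on the fundamental groupoid of the base. -/
def basedFibreFunctor (hp : covering p) (e₀ : E _⦋0⦌) : fundGrpd.obj K ⥤ Type u :=
  -- The universal property needs a groupoid as target; the core is available because steps are
  -- bijections.
  fundGrpd.lift (C := Core (Type u))
    { obj := fun x => ⟨BasedFibre p e₀ x⟩
      map := fun k => ⟨(BasedFibre.stepEquiv hp k).toIso⟩ }
    (fun _ => Core.hom_ext (ConcreteCategory.hom_ext _ _ fun s => BasedFibre.stepEquiv_id hp s))
    (fun z => Core.hom_ext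
      (ConcreteCategory.hom_ext _ _ fun s => BasedFibre.stepEquiv_comp hp z s)) ⋙
    Core.inclusion (Type u)

lemma basedFibreFunctor_edge (hp : covering p) {x y : K _⦋0⦌} (k : Edge x y)
    (s : BasedFibre p e₀ x) :
    (basedFibreFunctor hp e₀).map (fundGrpd.edge k) s = BasedFibre.stepEquiv hp k s := by
  have := congrArg (Core.inclusion (Type u)).map (fundGrpd.lift_edge (C := Core (Type u))
    { obj := fun x => ⟨BasedFibre p e₀ x⟩
      map := fun k => ⟨(BasedFibre.stepEquiv hp k).toIso⟩ }
    (fun _ => Core.hom_ext (ConcreteCategory.hom_ext _ _ fun s => BasedFibre.stepEquiv_id hp s))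
    (fun z => Core.hom_ext
      (ConcreteCategory.hom_ext _ _ fun s => BasedFibre.stepEquiv_comp hp z s)) k)
  exact types_congr_hom this s

/-- A morphism of the fundamental groupoid of the total space, as a point of a based fibre. -/
def BasedFibre.ofHom (p : E ⟶ K) {b : fundGrpd.obj E} (ψ : fundGrpd.vertex E e₀ ⟶ b) :
    BasedFibre p e₀ ((fundGrpd.mapFunctor p).obj b).as.as :=
  ⟨b.as.as, rfl, ψ⟩

/-- This is what makes lifts unique: with `ψ` the identity, the action of the image of `f` returns
`f` itself. Quantifying over `ψ` inside the induction is needed for composites and inverses. -/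
lemma basedFibreFunctor_map (hp : covering p) {a b : fundGrpd.obj E} (f : a ⟶ b) :
    ∀ ψ : fundGrpd.vertex E e₀ ⟶ a,
      (fundGrpd.mapFunctor p ⋙ basedFibreFunctor hp e₀).map f (BasedFibre.ofHom p ψ) =
        BasedFibre.ofHom p (ψ ≫ f) := by
  induction f using fundGrpd.hom_induction with
  | h_edge ε =>
    intro ψ
    rw [Functor.comp_map, fundGrpd.mapFunctor_edge]
    refine (basedFibreFunctor_edge hp _ _).trans (BasedFibre.stepEquiv_eq hp ⟨ε, ?_, rfl⟩)
    exact (Edge.map_edge ε p).symm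
  | h_comp f g hf hg =>
    intro ψ
    refine (Functor.map_comp_apply _ f g _).trans ?_
    refine (congrArg _ (hf ψ)).trans ((hg _).trans ?_)
    rw [Category.assoc]
  | h_inv f hf =>
    intro ψ
    -- Acting by `f` on this element gives `ψ`, so acting by the inverse of `f` on `ψ` must give it
    -- back.
    have := hf (ψ ≫ Groupoid.inv f)
    rw [Category.assoc, Groupoid.inv_comp, Category.comp_id] at this
    refine (congrArg _ this.symm).trans ((Functor.map_comp_apply _ f _ _).symm.trans ?_)
    rw [Groupoid.comp_inv]
    exact types_congr_hom (CategoryTheory.Functor.map_id _ _) _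

lemma isHomLift_edge {x y : K _⦋0⦌} (k : Edge x y) {a b : E _⦋0⦌} (ε : Edge a b)
    (ha : p.app _ a = x) (hb : p.app _ b = y) (h : p.app _ ε.edge = k.edge) :
    (fundGrpd.mapFunctor p).IsHomLift (fundGrpd.edge k) (fundGrpd.edge ε) := by
  subst ha hb
  obtain rfl : ε.map p = k := Edge.ext h
  rw [← fundGrpd.mapFunctor_edge]
  exact IsHomLift.map _ _

/-- Lifting from the source and from the target are proved together because inversion exchanges
them. -/
lemma covering.exists_isHomLift (hp : covering p) {x y : fundGrpd.obj K} (γ : x ⟶ y) :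
    (∀ a, (fundGrpd.mapFunctor p).obj a = x →
      ∃ (b : fundGrpd.obj E) (φ : a ⟶ b), (fundGrpd.mapFunctor p).IsHomLift γ φ) ∧
    (∀ b, (fundGrpd.mapFunctor p).obj b = y →
      ∃ (a : fundGrpd.obj E) (φ : a ⟶ b), (fundGrpd.mapFunctor p).IsHomLift γ φ) := by
  induction γ using fundGrpd.hom_induction with
  | @h_edge x y k =>
    refine ⟨fun a ha => ?_, fun b hb => ?_⟩
    · have ha' : p.app _ a.as.as = x := congrArg (fun t : fundGrpd.obj K => t.as.as) ha
      obtain ⟨b, ε, hb, h⟩ := hp.exists_edge_of_src k a.as.as ha'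
      exact ⟨_, _, isHomLift_edge k ε ha' hb h⟩
    · have hb' : p.app _ b.as.as = y := congrArg (fun t : fundGrpd.obj K => t.as.as) hb
      obtain ⟨a, ε, ha, h⟩ := hp.exists_edge_of_tgt k b.as.as hb'
      exact ⟨_, _, isHomLift_edge k ε ha hb' h⟩
  | h_comp f g hf hg =>
    refine ⟨fun a ha => ?_, fun c hc => ?_⟩
    · obtain ⟨b, φ, hφ⟩ := hf.1 a ha
      obtain ⟨c, ψ, hψ⟩ := hg.1 b (IsHomLift.codomain_eq _ f φ)
      exact ⟨c, φ ≫ ψ, inferInstance⟩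
    · obtain ⟨b, ψ, hψ⟩ := hg.2 c hc
      obtain ⟨a, φ, hφ⟩ := hf.2 b (IsHomLift.domain_eq _ g ψ)
      exact ⟨a, φ ≫ ψ, inferInstance⟩
  | h_inv f hf =>
    have key {a b : fundGrpd.obj E} (φ : a ⟶ b) (h : (fundGrpd.mapFunctor p).IsHomLift f φ) :
        (fundGrpd.mapFunctor p).IsHomLift (Groupoid.inv f) (Groupoid.inv φ) := by
      obtain ⟨⟩ := h
      rw [Groupoid.inv_eq_inv, ← Functor.map_inv, ← Groupoid.inv_eq_inv]
      infer_instance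
    refine ⟨fun b hb => ?_, fun a ha => ?_⟩
    · obtain ⟨a, φ, hφ⟩ := hf.2 b hb
      exact ⟨a, _, key φ hφ⟩
    · obtain ⟨b, φ, hφ⟩ := hf.1 a ha
      exact ⟨b, _, key φ hφ⟩

/-- The fundamental groupoid functor preserves coverings. -/
theorem covering.isCovering_mapFunctor (hp : covering p) :
    (fundGrpd.mapFunctor p).toPrefunctor.IsCovering := by
  have h_inj (a : fundGrpd.obj E) :
      Function.Injective ((fundGrpd.mapFunctor p).toPrefunctor.star a) := by
    -- A left inverse of the map on stars: let a morphism of the base act on the constant path at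
    -- `a` and read off the resulting path.
    let S (t : Quiver.Star ((fundGrpd.mapFunctor p).obj a)) : Quiver.Star a :=
      let s : BasedFibre p a.as.as t.1.as.as :=
        (basedFibreFunctor hp a.as.as).map t.2 (BasedFibre.ofHom p (𝟙 a))
      ⟨fundGrpd.vertex E s.pt, s.path⟩
    refine Function.LeftInverse.injective (g := S) fun t => ?_
    have h := (basedFibreFunctor_map hp t.2 (𝟙 a)).trans
      (congrArg (BasedFibre.ofHom p) (Category.id_comp t.2))
    exact congrArg (fun s : BasedFibre p a.as.as _ =>
      (⟨fundGrpd.vertex E s.pt, s.path⟩ : Quiver.Star a)) h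
  refine ⟨fun a => ⟨h_inj a, ?_⟩, fun b => ⟨?_, ?_⟩⟩
  · rintro ⟨y, γ⟩
    obtain ⟨b, φ, hφ⟩ := (hp.exists_isHomLift γ).1 a rfl
    exact ⟨⟨b, φ⟩, IsHomLift.star_eq (fundGrpd.mapFunctor p) γ φ hφ⟩
  · rintro ⟨a, φ⟩ ⟨a', φ'⟩ h
    -- Inversion turns costars into stars, where injectivity is already known.
    have hinv : (⟨a, Groupoid.inv φ⟩ : Quiver.Star b) = ⟨a', Groupoid.inv φ'⟩ := by
      apply h_inj
      have := congrArg (fun t : Quiver.Costar ((fundGrpd.mapFunctor p).obj b) =>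
        (⟨t.1, Groupoid.inv t.2⟩ : Quiver.Star ((fundGrpd.mapFunctor p).obj b))) h
      have hf {c : fundGrpd.obj E} (f : c ⟶ b) : (fundGrpd.mapFunctor p).map (Groupoid.inv f) =
          Groupoid.inv ((fundGrpd.mapFunctor p).map f) := by simp
      change (⟨_, (fundGrpd.mapFunctor p).map (Groupoid.inv φ)⟩ : Quiver.Star _) =
        ⟨_, (fundGrpd.mapFunctor p).map (Groupoid.inv φ')⟩
      rw [hf, hf]
      exact this
    have := congrArg (fun t : Quiver.Star b =>
      (⟨t.1, Groupoid.inv t.2⟩ : Quiver.Costar b)) hinv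
    simpa using this
  · rintro ⟨x, γ⟩
    obtain ⟨a, φ, hφ⟩ := (hp.exists_isHomLift γ).2 b rfl
    exact ⟨⟨a, φ⟩, IsHomLift.costar_eq (fundGrpd.mapFunctor p) γ φ hφ⟩

end

/-! ### Coverings of a simplicial set and of its fundamental groupoid -/

section

variable {E E' K : SSet.{u}} {p : E ⟶ K} {q : E' ⟶ K}

lemma covering.hom_ext (hq : covering q) {f g : E ⟶ E'} (h : f ≫ q = g ≫ q)
    (h₀ : ∀ e : E _⦋0⦌, f.app _ e = g.app _ e) : f = g := by
  refine NatTrans.ext (funext fun n => ConcreteCategory.hom_ext _ _ fun σ => ?_)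
  refine hq.eq_of_vtx (m := n.unop.len) 0 ?_ ?_
  · exact (app_vtx f σ 0).symm.trans ((h₀ _).trans (app_vtx g σ 0))
  · exact types_congr_hom (NatTrans.congr_app h n) σ

/-- The edge from the first vertex of a simplex to another vertex. -/
def firstEdge {m : ℕ} (σ : K _⦋m⦌) (i : Fin (m + 1)) : Edge (vtx σ 0) (vtx σ i) :=
  Edge.mk (K.map (SimplexCategory.mkOfLe 0 i (Fin.zero_le i)).op σ)
    ((δ_one_eq_vtx _).trans (vtx_map _ σ 0)) ((δ_zero_eq_vtx _).trans (vtx_map _ σ 1))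

variable (F : fundGrpd.obj E ⥤ fundGrpd.obj E')

/-- The action on vertices of a functor between fundamental groupoids. -/
def vertexMap (e : E _⦋0⦌) : E' _⦋0⦌ := (F.obj (fundGrpd.vertex E e)).as.as

variable {F}

lemma app_vertexMap (hF : F ⋙ fundGrpd.mapFunctor q = fundGrpd.mapFunctor p) (e : E _⦋0⦌) :
    q.app _ (vertexMap F e) = p.app _ e :=
  congrArg (fun a : fundGrpd.obj K => a.as.as) (Functor.congr_obj hF (fundGrpd.vertex E e))

/-- The class of `ε'` and the image under `F` of the class of `ε` start at the same point and lift
the same morphism, so they end at the same point. -/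
lemma covering.eq_vertexMap (hq : covering q)
    (hF : F ⋙ fundGrpd.mapFunctor q = fundGrpd.mapFunctor p) {a b : E _⦋0⦌} {a' b' : E' _⦋0⦌}
    (ε : Edge a b) (ε' : Edge a' b') (h : q.app _ ε'.edge = p.app _ ε.edge)
    (ha : a' = vertexMap F a) : b' = vertexMap F b := by
  subst ha
  have h₁ : (fundGrpd.mapFunctor q).IsHomLift (fundGrpd.edge (ε.map p)) (fundGrpd.edge ε') :=
    isHomLift_edge _ _ (app_vertexMap hF a)
      (by rw [← ε'.vtx_one, app_vtx, h, ← app_vtx, ε.vtx_one]) h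
  have h₂ : (fundGrpd.mapFunctor q).IsHomLift (fundGrpd.edge (ε.map p))
      (F.map (fundGrpd.edge ε)) :=
    Grpd.isHomLift_map_of_comp_eq hF _ _ (isHomLift_edge _ _ rfl rfl rfl)
  exact congrArg (fun a : fundGrpd.obj E' => a.as.as)
    (IsHomLift.codomain_unique hq.isCovering_mapFunctor _ _ _ h₁ h₂)

/-- Only vertex 0 is prescribed when lifting; the edges leaving it settle the remaining vertices.
Recording all vertices is needed for naturality, since a simplicial operator may send vertex 0 to
another vertex. -/
lemma covering.existsUnique_simplex (hq : covering q)
    (hF : F ⋙ fundGrpd.mapFunctor q = fundGrpd.mapFunctor p) {m : ℕ} (σ : E _⦋m⦌) :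
    ∃! r : E' _⦋m⦌, (∀ i, vtx r i = vertexMap F (vtx σ i)) ∧ q.app _ r = p.app _ σ := by
  obtain ⟨r, ⟨h1, h2⟩, -⟩ := covering_iff.1 hq m 0 (vertexMap F (vtx σ 0)) (p.app _ σ)
    ((app_vertexMap hF _).trans (app_vtx p σ 0))
  refine ⟨r, ⟨fun i => hq.eq_vertexMap hF (firstEdge σ i) (firstEdge r i) ?_ h1, h2⟩,
    fun r' hr' => hq.eq_of_vtx 0 ((hr'.1 0).trans h1.symm) (hr'.2.trans h2.symm)⟩
  refine (NatTrans.naturality_apply q _ r).trans (Eq.trans ?_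
    (NatTrans.naturality_apply p _ σ).symm)
  exact congrArg _ h2

/-- A functor between fundamental groupoids over the fundamental groupoid of the base is induced by
a morphism of coverings. -/
lemma covering.exists_hom (hq : covering q)
    (hF : F ⋙ fundGrpd.mapFunctor q = fundGrpd.mapFunctor p) :
    ∃ f : E ⟶ E', f ≫ q = p ∧ ∀ e : E _⦋0⦌, f.app _ e = vertexMap F e := by
  choose f hf _ using fun (n : SimplexCategoryᵒᵖ) (σ : E.obj n) =>
    hq.existsUnique_simplex hF (m := n.unop.len) σ
  refine ⟨{ app := fun n => ↾(f n), naturality := fun n m θ => ?_ }, ?_, fun e => ?_⟩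
  · refine ConcreteCategory.hom_ext _ _ fun σ => ?_
    refine hq.eq_of_vtx (m := m.unop.len) 0 ?_ ?_
    · refine ((hf m (E.map θ σ)).1 0).trans ?_
      refine (congrArg _ (vtx_map θ.unop σ 0)).trans ?_
      exact ((hf n σ).1 _).symm.trans (vtx_map θ.unop (f n σ) 0).symm
    · refine (hf m (E.map θ σ)).2.trans ((NatTrans.naturality_apply p θ σ).trans ?_)
      exact (congrArg _ (hf n σ).2.symm).trans (NatTrans.naturality_apply q θ (f n σ)).symm
  · refine NatTrans.ext (funext fun n => ConcreteCategory.hom_ext _ _ fun σ => ?_)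
    exact (hf n σ).2
  · have := (hf (op ⦋0⦌) e).1 0
    exact (vtx_zero _).symm.trans (this.trans (congrArg _ (vtx_zero e)))

end

/-- The functor from coverings of a simplicial set to coverings of its fundamental groupoid. -/
def covFundGrpd (K : SSet.{u}) : Cov K ⥤ Grpd.Cov (fundGrpd.obj K) :=
  ObjectProperty.lift _ (ObjectProperty.ι _ ⋙ Over.post SSet.fundGrpd)
    fun p => covering.isCovering_mapFunctor p.property

instance (K : SSet.{u}) : (covFundGrpd K).Faithful where
  map_injective {p q f g} h := by
    apply ObjectProperty.hom_ext
    apply Over.OverMorphism.ext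
    refine covering.hom_ext q.property ((Over.w f.hom).trans (Over.w g.hom).symm) fun e => ?_
    exact congrArg (fun F : (covFundGrpd K).obj p ⟶ (covFundGrpd K).obj q =>
      ((Grpd.Cov.homFunctor F).obj (fundGrpd.vertex p.obj.left e)).as.as) h

instance (K : SSet.{u}) : (covFundGrpd K).Full where
  map_surjective {p q} F := by
    obtain ⟨f, hf, hf'⟩ := covering.exists_hom (p := p.obj.hom) (q := q.obj.hom)
      (F := Grpd.Cov.homFunctor F) q.property (Grpd.Cov.homFunctor_comp_proj F)
    refine ⟨ObjectProperty.homMk (Over.homMk f hf), Grpd.Cov.hom_ext_obj fun a => ?_⟩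
    exact congrArg (fundGrpd.vertex q.obj.left) (hf' a.as.as)

end SSet

namespace Digr

variable {X E E' : Digr.{u}}

/-! ### Distances and coverings of digraphs -/

lemma HasPath.eq_of_zero {x y : X.V} (h : X.HasPath 0 x y) : x = y := by
  cases h
  rfl

lemma eq_of_dist_eq_zero {x y : X.V} (h : X.dist x y = 0) : x = y := by
  obtain ⟨n, hn, hn'⟩ := exists_hasPath_of_dist_ne_top (X := X) (x := x) (y := y) (by simp [h])
  obtain rfl : n = 0 := by exact_mod_cast hn'.symm.trans h
  exact hn.eq_of_zero

lemma E₁_iff_dist_le {x y : X.V} : X.E₁ x y ↔ X.dist x y ≤ 1 := by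
  refine ⟨E₁.dist_le, fun h => ?_⟩
  obtain ⟨n, hn, hn'⟩ := exists_hasPath_of_dist_ne_top
    (ne_top_of_le_ne_top (by simp) h)
  have hle : n ≤ 1 := by
    rw [hn'] at h
    exact_mod_cast h
  cases hn with
  | nil => exact Or.inl rfl
  | @snoc n _ z _ h e =>
    obtain rfl : n = 0 := by omega
    obtain rfl := h.eq_of_zero
    exact e

lemma D_E₁_iff {n : ℕ} {x y : X.V} : ((D n).obj X).E₁ x y ↔ X.dist x y ≤ n := by
  refine ⟨?_, fun h => ?_⟩
  · rintro (rfl | h)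
    · simp
    · exact h.2
  · by_cases hxy : x = y
    · exact Or.inl hxy
    · exact Or.inr ⟨hxy, h⟩

section

variable {l : ℕ} {p : E ⟶ X}

lemma lCovering_iff : lCovering l p ↔ ∀ n : ℕ, 1 ≤ n → n ≤ l →
    (∀ (e : E.V) (x : X.V), X.dist (p.toFun e) x ≤ n →
      ∃! e' : E.V, E.dist e e' ≤ n ∧ p.toFun e' = x) ∧
    (∀ (e : E.V) (x : X.V), X.dist x (p.toFun e) ≤ n →
      ∃! e' : E.V, E.dist e' e ≤ n ∧ p.toFun e' = x) := by
  refine forall₃_congr fun n _ _ => and_congr ?_ ?_ <;>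
  refine forall₂_congr fun e x => imp_congr D_E₁_iff ?_
  · exact existsUnique_congr fun e' => and_congr_left' D_E₁_iff
  · exact existsUnique_congr fun e' => and_congr_left' D_E₁_iff

/-- Unique lifting in `D m` is applied with `m` the exact distance; the reverse inequality holds
since morphisms do not increase distances. Distance zero is separate because the covering condition
starts at `n = 1`. -/
lemma lCovering.exists_dist_eq_of_src (hp : lCovering l p) (e : E.V) (x : X.V)
    (h : X.dist (p.toFun e) x ≤ l) :
    ∃ e', p.toFun e' = x ∧ E.dist e e' = X.dist (p.toFun e) x := by
  obtain ⟨m, -, hm⟩ := exists_hasPath_of_dist_ne_top (ne_top_of_le_ne_top (by simp) h)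
  obtain rfl | hm0 := Nat.eq_zero_or_pos m
  · exact ⟨e, eq_of_dist_eq_zero hm, by simp [hm]⟩
  · rw [hm] at h
    obtain ⟨e', ⟨h1, rfl⟩, -⟩ :=
      (lCovering_iff.1 hp m hm0 (by exact_mod_cast h)).1 e x hm.le
    exact ⟨e', rfl, le_antisymm (h1.trans hm.ge) (dist_map_le p e e')⟩

lemma lCovering.exists_dist_eq_of_tgt (hp : lCovering l p) (e : E.V) (x : X.V)
    (h : X.dist x (p.toFun e) ≤ l) :
    ∃ e', p.toFun e' = x ∧ E.dist e' e = X.dist x (p.toFun e) := by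
  obtain ⟨m, -, hm⟩ := exists_hasPath_of_dist_ne_top (ne_top_of_le_ne_top (by simp) h)
  obtain rfl | hm0 := Nat.eq_zero_or_pos m
  · exact ⟨e, (eq_of_dist_eq_zero hm).symm, by simp [hm]⟩
  · rw [hm] at h
    obtain ⟨e', ⟨h1, rfl⟩, -⟩ :=
      (lCovering_iff.1 hp m hm0 (by exact_mod_cast h)).2 e x hm.le
    exact ⟨e', rfl, le_antisymm (h1.trans hm.ge) (dist_map_le p e' e)⟩

variable (hl : 1 ≤ l)
include hl

lemma lCovering.eq_of_dist_le_of_src (hp : lCovering l p) {e a b : E.V}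
    (ha : E.dist e a ≤ l) (hb : E.dist e b ≤ l) (h : p.toFun a = p.toFun b) : a = b :=
  ((lCovering_iff.1 hp l hl le_rfl).1 e (p.toFun b) ((dist_map_le p e b).trans hb)).unique
    ⟨ha, h⟩ ⟨hb, rfl⟩

lemma lCovering.eq_of_dist_le_of_tgt (hp : lCovering l p) {e a b : E.V}
    (ha : E.dist a e ≤ l) (hb : E.dist b e ≤ l) (h : p.toFun a = p.toFun b) : a = b :=
  ((lCovering_iff.1 hp l hl le_rfl).2 e (p.toFun b) ((dist_map_le p b e).trans hb)).unique
    ⟨ha, h⟩ ⟨hb, rfl⟩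

/-- The distance-preserving lift of the image of `e'` also lies within `l` of `e`, hence is `e'` by
uniqueness in `D l`. -/
lemma lCovering.dist_eq (hp : lCovering l p) {e e' : E.V} (h : E.dist e e' ≤ l) :
    E.dist e e' = X.dist (p.toFun e) (p.toFun e') := by
  have h' := (dist_map_le p e e').trans h
  obtain ⟨a, ha, hd⟩ := hp.exists_dist_eq_of_src e _ h'
  obtain rfl := hp.eq_of_dist_le_of_src hl (hd.trans_le h') h ha
  exact hd

end

/-! ### Coverings of digraphs induce coverings of filtered nerves -/

lemma dist_le_length {n : ℕ} (x : Fin (n + 1) → X.V) {i j : Fin (n + 1)} (h : i ≤ j) :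
    X.dist (x i) (x j) ≤ X.length x := by
  refine le_trans (le_of_eq ?_) (length_comp_le x (SimplexCategory.mkOfLe i j h).toOrderHom)
  simp [length]
  rfl

lemma dist_add_dist_le_length {n : ℕ} (x : Fin (n + 1) → X.V) {i j k : Fin (n + 1)} (h : i ≤ j)
    (h' : j ≤ k) : X.dist (x i) (x j) + X.dist (x j) (x k) ≤ X.length x := by
  refine le_trans (le_of_eq ?_)
    (length_comp_le x (SimplexCategory.mkOfLeComp i j k h h').toOrderHom)
  simp [length, Fin.sum_univ_two]
  rfl

section

variable {l : ℕ} (hl : 1 ≤ l) {p : E ⟶ X}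
include hl

lemma lCovering.exists_lift (hp : lCovering l p) {m : ℕ} (k : Fin (m + 1)) (e : E.V)
    (x : Fin (m + 1) → X.V) (hx : X.length x ≤ l) (hk : p.toFun e = x k) :
    ∃ r : Fin (m + 1) → E.V, r k = e ∧ p.toFun ∘ r = x ∧ E.length r ≤ l := by
  -- Each vertex is lifted straight from `e`, forwards after `k` and backwards before it, without
  -- regard to its neighbours.
  have hr : ∀ j, ∃ a : E.V, p.toFun a = x j ∧ (k ≤ j → E.dist e a = X.dist (x k) (x j)) ∧
      (j ≤ k → E.dist a e = X.dist (x j) (x k)) := by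
    intro j
    rcases lt_trichotomy k j with h | rfl | h
    · obtain ⟨a, ha, hd⟩ := hp.exists_dist_eq_of_src e (x j)
        (hk ▸ (dist_le_length x h.le).trans hx)
      exact ⟨a, ha, fun _ => hk ▸ hd, fun h' => absurd h' h.not_ge⟩
    · exact ⟨e, hk, by simp, by simp⟩
    · obtain ⟨a, ha, hd⟩ := hp.exists_dist_eq_of_tgt e (x j)
        (hk ▸ (dist_le_length x h.le).trans hx)
      exact ⟨a, ha, fun h' => absurd h' h.not_ge, fun _ => hk ▸ hd⟩
  choose r hrx hr₁ hr₂ using hr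
  refine ⟨r, ?_, funext hrx, ?_⟩
  · exact (eq_of_dist_eq_zero ((hr₁ k le_rfl).trans (dist_self _))).symm
  refine le_trans (le_of_eq (Finset.sum_congr rfl fun i _ => ?_)) hx
  have hi : i.castSucc ≤ i.succ := i.castSucc_lt_succ.le
  have hix : X.dist (x i.castSucc) (x i.succ) ≤ l := (dist_le_length x hi).trans hx
  rcases le_or_gt k i.castSucc with h | h
  · obtain ⟨a, ha, hd⟩ := hp.exists_dist_eq_of_src (r i.castSucc) (x i.succ) (by rwa [hrx])
    -- Going from `e` through `r i.castSucc` to `a` costs at most the length of `x`, so `a` and `r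
    -- i.succ` both lie within `l` of `e` over the same vertex.
    obtain rfl : a = r i.succ := by
      refine hp.eq_of_dist_le_of_src hl (e := e) ?_ ?_ (ha.trans (hrx _).symm)
      · refine (dist_triangle _ (r i.castSucc) _).trans ?_
        rw [hd, hr₁ _ h, hrx]
        exact (dist_add_dist_le_length x h hi).trans hx
      · rw [hr₁ _ (h.trans hi)]
        exact (dist_le_length x (h.trans hi)).trans hx
    rw [hd, hrx]
  · have h : i.succ ≤ k := Fin.castSucc_lt_iff_succ_le.1 h
    obtain ⟨a, ha, hd⟩ := hp.exists_dist_eq_of_tgt (r i.succ) (x i.castSucc) (by rwa [hrx])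
    obtain rfl : a = r i.castSucc := by
      refine hp.eq_of_dist_le_of_tgt hl (e := e) ?_ ?_ (ha.trans (hrx _).symm)
      · refine (dist_triangle _ (r i.succ) _).trans ?_
        rw [hd, hr₂ _ h, hrx]
        exact (dist_add_dist_le_length x hi h).trans hx
      · rw [hr₂ _ (hi.trans h)]
        exact (dist_le_length x (hi.trans h)).trans hx
    rw [hd, hrx]

lemma lCovering.lift_unique (hp : lCovering l p) {m : ℕ} (k : Fin (m + 1))
    {r r' : Fin (m + 1) → E.V} (hr : E.length r ≤ l) (hr' : E.length r' ≤ l) (hk : r k = r' k)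
    (h : p.toFun ∘ r = p.toFun ∘ r') : r = r' := by
  funext j
  rcases le_total k j with hj | hj
  · exact hp.eq_of_dist_le_of_src hl ((dist_le_length r hj).trans hr)
      (hk ▸ (dist_le_length r' hj).trans hr') (congrFun h j)
  · exact hp.eq_of_dist_le_of_tgt hl ((dist_le_length r hj).trans hr)
      (hk ▸ (dist_le_length r' hj).trans hr') (congrFun h j)

/-- The filtered nerve of an `l`-covering is a covering. -/
theorem lCovering.covering_nerve_map (hp : lCovering l p) :
    SSet.covering ((nerve l).map p) := by
  rw [SSet.covering_iff]
  intro m k e t h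
  have hk : p.toFun (e.1 0) = t.1 k := congrFun (congrArg Subtype.val h) 0
  obtain ⟨r, hr, hrt, hrl⟩ := hp.exists_lift hl k (e.1 0) t.1 t.2.2 hk
  refine ⟨⟨r, isAccessible_of_length_le hrl, hrl⟩, ⟨?_, Subtype.ext hrt⟩, ?_⟩
  · refine Subtype.ext (funext fun i => ?_)
    obtain rfl : i = 0 := Subsingleton.elim (α := Fin 1) _ _
    exact hr
  · rintro r' ⟨h1, h2⟩
    refine Subtype.ext (hp.lift_unique hl k r'.2.2 hrl ?_ ?_)
    · exact (congrFun (congrArg Subtype.val h1) 0).trans hr.symm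
    · exact (congrArg Subtype.val h2).trans hrt.symm

end

/-! ### Full faithfulness of the nerve on `l`-coverings -/

lemma vertexSimplex_eq {l : ℕ} (x : ((nerve l).obj X).obj (op (SimplexCategory.mk 0))) :
    vertexSimplex l (x.1 0) = x := by
  refine Subtype.ext (funext fun i => ?_)
  obtain rfl : i = 0 := Subsingleton.elim (α := Fin 1) _ _
  rfl

lemma vtx_nerve_apply {l m : ℕ} (σ : ((nerve l).obj X).obj (op (SimplexCategory.mk m)))
    (k : Fin (m + 1)) : (SSet.vtx (K := (nerve l).obj X) σ k).1 0 = σ.1 k := rfl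

/-- The functor from `l`-coverings of a digraph to coverings of its filtered nerve. -/
def covNerve {l : ℕ} (hl : 1 ≤ l) (X : Digr.{u}) : Cov l X ⥤ SSet.Cov ((nerve l).obj X) :=
  ObjectProperty.lift _ (ObjectProperty.ι _ ⋙ Over.post (nerve l))
    fun p => lCovering.covering_nerve_map hl p.property

instance {l : ℕ} (hl : 1 ≤ l) (X : Digr.{u}) : (covNerve hl X).Faithful where
  map_injective {p q f g} h := by
    apply ObjectProperty.hom_ext
    apply Over.OverMorphism.ext
    refine hom_ext (funext fun e => ?_)
    exact congrArg (fun F : (covNerve hl X).obj p ⟶ (covNerve hl X).obj q =>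
      (F.hom.left.app (op (SimplexCategory.mk 0)) (vertexSimplex l e)).1 0) h

/-- The morphism of digraphs over `X` given by a morphism of filtered nerves. -/
def homOfNerve {l : ℕ} (hl : 1 ≤ l) {p : E ⟶ X} {q : E' ⟶ X} (hq : lCovering l q)
    (F : (nerve l).obj E ⟶ (nerve l).obj E') (hF : F ≫ (nerve l).map q = (nerve l).map p) :
    E ⟶ E' where
  toFun e := (F.app (op (SimplexCategory.mk 0)) (vertexSimplex l e)).1 0
  map_E₁ a b h := by
    have hF₀ (e : E.V) : q.toFun ((F.app (op (SimplexCategory.mk 0)) (vertexSimplex l e)).1 0) =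
        p.toFun e :=
      congrFun (congrArg Subtype.val (types_congr_hom (NatTrans.congr_app hF
        (op (SimplexCategory.mk 0))) (vertexSimplex l e))) 0
    let τ := (SSet.Edge.map (edgeSimplex hl h) F).edge
    have hd := (dist_le_length τ.1 (zero_le_one (α := Fin 2))).trans τ.2.2
    have h0 := (SSet.Edge.map (edgeSimplex hl h) F).vtx_zero
    have h1 := (SSet.Edge.map (edgeSimplex hl h) F).vtx_one
    rw [← vtx_nerve_apply τ 0, ← vtx_nerve_apply τ 1, h0, h1] at hd
    -- The image edge is only known to have length at most `l`; within that range distances in the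
    -- covering `E'` agree with those in `X`, where the bound 1 is available.
    rw [E₁_iff_dist_le, hq.dist_eq hl hd, hF₀, hF₀]
    exact (dist_map_le p a b).trans h.dist_le

instance {l : ℕ} (hl : 1 ≤ l) (X : Digr.{u}) : (covNerve hl X).Full where
  map_surjective {p q} F := by
    have hF : F.hom.left ≫ (nerve l).map q.obj.hom = (nerve l).map p.obj.hom := Over.w F.hom
    refine ⟨ObjectProperty.homMk (Over.homMk (homOfNerve hl q.property F.hom.left hF) ?_), ?_⟩
    · refine hom_ext (funext fun e => ?_)
      exact congrFun (congrArg Subtype.val (types_congr_hom (NatTrans.congr_app hF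
        (op (SimplexCategory.mk 0))) (vertexSimplex l e))) 0
    · apply ObjectProperty.hom_ext
      apply Over.OverMorphism.ext
      refine SSet.covering.hom_ext ((covNerve hl X).obj q).property
        ((Over.w _).trans (Over.w _).symm) fun e => ?_
      obtain ⟨e, rfl⟩ : ∃ e', vertexSimplex l e' = e := ⟨_, vertexSimplex_eq e⟩
      exact vertexSimplex_eq (F.hom.left.app (op (SimplexCategory.mk 0)) (vertexSimplex l e))

end Digr

namespace Digr

variable {X : Digr.{u}} {l : ℕ}

/-! ### Fibres of coverings of digraphs -/

/-- The composite of the functors from `l`-coverings of `X` to presheaves on `Πˡ(X)`. -/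
def covPresheaf (hl : 1 ≤ l) (X : Digr.{u}) : Cov l X ⥤ ((X.fundGrpd l)ᵒᵖ ⥤ Type u) :=
  (covNerve hl X ⋙ SSet.covFundGrpd _) ⋙ Grpd.fibreFunctor _

lemma vertex_eq (g : X.fundGrpd l) : vertex l (g.as.as.1 0) = g :=
  congrArg (SSet.fundGrpd.vertex _) (vertexSimplex_eq g.as.as)

/-- The fibre of `Π(𝒩ˡ(p))` over a vertex is the fibre of `p`. -/
def fibreEquiv (hl : 1 ≤ l) (p : Cov l X) (x : X.V) :
    Grpd.Cov.Fibre ((covNerve hl X ⋙ SSet.covFundGrpd _).obj p) (vertex l x) ≃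
      (fibre x).obj p.obj where
  toFun h := ⟨h.1.as.as.1 0, congrFun (congrArg Subtype.val
    (congrArg (fun g : X.fundGrpd l => g.as.as) h.2)) 0⟩
  invFun e := ⟨vertex l e.1, congrArg (vertex l) e.2⟩
  left_inv h := Subtype.ext (vertex_eq h.1)
  right_inv _ := rfl

/-- The presheaf associated with a covering `p` has the value `p⁻¹(x)` at `x`. -/
def covPresheafEvaluationIso (hl : 1 ≤ l) (x : X.V) :
    covPresheaf hl X ⋙ (evaluation (X.fundGrpd l)ᵒᵖ (Type u)).obj (op (vertex l x)) ≅
      ObjectProperty.ι _ ⋙ fibre x :=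
  NatIso.ofComponents (fun p => (fibreEquiv hl p x).toIso) fun _ => rfl

lemma fibreEquiv_transport (hl : 1 ≤ l) (p : Cov l X) {x' x : X.V} (h : X.E₁ x' x)
    (s : Grpd.Cov.Fibre ((covNerve hl X ⋙ SSet.covFundGrpd _).obj p) (vertex l x))
    (e' : (fibre x').obj p.obj) (he : p.obj.left.E₁ e'.1 (fibreEquiv hl p x s).1) :
    fibreEquiv hl p x' (Grpd.Cov.transport _ (arrow hl h) s) = e' := by
  rw [← Equiv.eq_symm_apply]
  obtain ⟨e, rfl⟩ := (fibreEquiv hl p x).symm.surjective s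
  rw [Equiv.apply_symm_apply] at he
  refine Grpd.Cov.IsTransport.eq ⟨arrow hl he, ?_⟩
  refine SSet.isHomLift_edge (p := (nerve l).map p.obj.hom) (edgeSimplex hl h)
    (edgeSimplex hl he) (congrArg (vertexSimplex l) e'.2) (congrArg (vertexSimplex l) e.2) ?_
  refine Subtype.ext (funext fun (i : Fin 2) => ?_)
  fin_cases i
  · exact e'.2
  · exact e.2

/-- For the converse, the case `n = 1` of the covering condition supplies some lift of the arrow,
which must then be the transport. -/
lemma E₁_fibreEquiv_iff (hl : 1 ≤ l) (p : Cov l X) {x' x : X.V} (h : X.E₁ x' x)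
    (s : Grpd.Cov.Fibre ((covNerve hl X ⋙ SSet.covFundGrpd _).obj p) (vertex l x))
    (e' : (fibre x').obj p.obj) :
    p.obj.left.E₁ e'.1 (fibreEquiv hl p x s).1 ↔
      e' = fibreEquiv hl p x' (Grpd.Cov.transport _ (arrow hl h) s) := by
  refine ⟨fun he => (fibreEquiv_transport hl p h s e' he).symm, ?_⟩
  rintro rfl
  have hd : X.dist x' (p.obj.hom.toFun (fibreEquiv hl p x s).1) ≤ 1 := by
    rw [(fibreEquiv hl p x s).2]
    exact h.dist_le
  obtain ⟨e', ⟨h1, h2⟩, -⟩ := (lCovering_iff.1 p.property 1 le_rfl hl).2 _ x' (by simpa using hd)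
  have he : p.obj.left.E₁ e' (fibreEquiv hl p x s).1 := E₁_iff_dist_le.2 (by simpa using h1)
  rw [fibreEquiv_transport hl p h s ⟨e', h2⟩ he]
  exact he

/-! ### Morphisms of `Πˡ(X)` between vertices at distance at most `l` -/

/-- A pair of vertices at distance at most `l` as a `1`-simplex of `𝒩ˡ(X)`. -/
def distSimplex {x y : X.V} (h : X.dist x y ≤ l) :
    SSet.Edge (vertexSimplex l x) (vertexSimplex l y) :=
  have hlen : X.length ![x, y] ≤ l := by simpa [length] using h
  SSet.Edge.mk (X := (nerve l).obj X) ⟨![x, y], isAccessible_of_length_le hlen, hlen⟩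
    (Subtype.ext (funext fun i => by fin_cases i; rfl))
    (Subtype.ext (funext fun i => by fin_cases i; rfl))

/-- A pair of vertices at distance at most `l` as a morphism of `Πˡ(X)`. -/
def distArrow {x y : X.V} (h : X.dist x y ≤ l) : vertex l x ⟶ vertex l y :=
  SSet.fundGrpd.edge (distSimplex h)

lemma arrow_eq_distArrow (hl : 1 ≤ l) {x y : X.V} (h : X.E₁ x y) (h' : X.dist x y ≤ l) :
    arrow hl h = distArrow h' := rfl

lemma distArrow_self (x : X.V) (h : X.dist x x ≤ l) : distArrow h = 𝟙 (vertex l x) := by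
  refine Eq.trans ?_ (SSet.fundGrpd.edge_id _)
  refine congrArg SSet.fundGrpd.edge (SSet.Edge.ext (Subtype.ext (funext fun (i : Fin 2) => ?_)))
  fin_cases i <;> rfl

/-- The bound on the sum says exactly that `(x, y, z)` is a 2-simplex of the nerve. -/
lemma distArrow_comp {x y z : X.V} (h : X.dist x y + X.dist y z ≤ l) (h₁ : X.dist x y ≤ l)
    (h₂ : X.dist y z ≤ l) (h₃ : X.dist x z ≤ l) :
    distArrow h₁ ≫ distArrow h₂ = distArrow h₃ := by
  have hlen : X.length ![x, y, z] ≤ l := by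
    simpa [length, Fin.sum_univ_two] using h
  refine SSet.fundGrpd.edge_comp (SSet.Edge.CompStruct.mk (X := (nerve l).obj X)
    ⟨![x, y, z], isAccessible_of_length_le hlen, hlen⟩ ?_ ?_ ?_) <;>
  · refine Subtype.ext (funext fun (i : Fin 2) => ?_)
    fin_cases i <;> rfl

lemma edge_eq_distArrow {x y : X.V} (ε : SSet.Edge (vertexSimplex l x) (vertexSimplex l y)) :
    ∃ h : X.dist x y ≤ l, SSet.fundGrpd.edge ε = distArrow h := by
  have h0 : ε.edge.1 0 = x := congrFun (congrArg Subtype.val ε.vtx_zero) 0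
  have h1 : ε.edge.1 1 = y := congrFun (congrArg Subtype.val ε.vtx_one) 0
  have h : X.dist x y ≤ l := by
    have hd := (dist_le_length ε.edge.1 (zero_le_one (α := Fin 2))).trans ε.edge.2.2
    rwa [h0, h1] at hd
  refine ⟨h, congrArg SSet.fundGrpd.edge
    (SSet.Edge.ext (Subtype.ext (funext fun (i : Fin 2) => ?_)))⟩
  fin_cases i
  · exact h0
  · exact h1

/-! ### The covering defined by a presheaf -/

section

variable (hl : 1 ≤ l) (L : (X.fundGrpd l)ᵒᵖ ⥤ Type u)

lemma total_E₁_iff {a b : ((total l hl X).obj L).left.V} :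
    ((total l hl X).obj L).left.E₁ a b ↔
      ∃ h : X.E₁ a.1 b.1, a.2 = L.map (arrow hl h).op b.2 := by
  have hself {x : X.V} (h : X.E₁ x x) (t : L.obj (op (vertex l x))) :
      L.map (arrow hl h).op t = t := by
    rw [arrow_eq_distArrow hl h (by simp), distArrow_self, op_id, L.map_id_apply]
  constructor
  · rintro (rfl | ⟨h, h'⟩)
    · exact ⟨Or.inl rfl, (hself _ _).symm⟩
    · exact ⟨Or.inr h, h'⟩
  · obtain ⟨x, s⟩ := a
    obtain ⟨y, t⟩ := b
    rintro ⟨h | h, h'⟩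
    · dsimp only at h h'
      subst h
      obtain rfl := h'.trans (hself (Or.inl rfl) t)
      exact Or.inl rfl
    · exact Or.inr ⟨h, h'⟩

/-- A path of length at most `l` is absorbed one arrow at a time by `distArrow_comp`, so its effect
on `L` depends on its end points alone. -/
lemma total_hasPath_iff {m : ℕ} (hm : m ≤ l) {a b : ((total l hl X).obj L).left.V} :
    ((total l hl X).obj L).left.HasPath m a b ↔
      ∃ h : X.HasPath m a.1 b.1,
        a.2 = L.map (distArrow (h.dist_le.trans (by exact_mod_cast hm))).op b.2 := by
  have hcomp {n : ℕ} (hn : n + 1 ≤ l) {x y z : X.V} (h : X.HasPath n x y) (e : X.E₁ y z)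
      (h₁ : X.dist x y ≤ l) (h₃ : X.dist x z ≤ l) (t : L.obj (op (vertex l z))) :
      L.map (distArrow h₁).op (L.map (arrow hl e).op t) = L.map (distArrow h₃).op t := by
    rw [arrow_eq_distArrow hl e (e.dist_le.trans (by exact_mod_cast hl)), ← L.map_comp_apply,
      ← op_comp, distArrow_comp]
    refine (add_le_add h.dist_le e.dist_le).trans ?_
    exact_mod_cast hn
  constructor
  · intro h
    induction h with
    | nil => exact ⟨.nil, by rw [distArrow_self, op_id, L.map_id_apply]⟩
    | snoc _ e ih =>
      obtain ⟨h, hs⟩ := ih (by omega)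
      obtain ⟨e, ht⟩ := (total_E₁_iff hl L).1 e
      refine ⟨h.snoc e, ?_⟩
      rw [hs, ht, hcomp hm h e]
  · obtain ⟨x, s⟩ := a
    obtain ⟨y, t⟩ := b
    rintro ⟨(h : X.HasPath m x y), hs⟩
    obtain rfl : s = L.map (distArrow (X := X) (x := x) (y := y)
      (h.dist_le.trans (by exact_mod_cast hm))).op t := hs
    induction h with
    | nil =>
      rw [distArrow_self, op_id, L.map_id_apply]
      exact .nil
    | @snoc n x y z h e ih =>
      rw [← hcomp hm h e (h.dist_le.trans (by exact_mod_cast (Nat.le_of_succ_le hm)))]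
      exact (ih (by omega) (L.map (arrow hl e).op t)).snoc ((total_E₁_iff hl L).2 ⟨e, rfl⟩)

lemma total_dist_le_iff {n : ℕ} (hn : n ≤ l) {a b : ((total l hl X).obj L).left.V} :
    ((total l hl X).obj L).left.dist a b ≤ n ↔
      ∃ h : X.dist a.1 b.1 ≤ n,
        a.2 = L.map (distArrow (h.trans (by exact_mod_cast hn))).op b.2 := by
  constructor
  · intro h
    obtain ⟨m, hm, hm'⟩ := exists_hasPath_of_dist_ne_top (ne_top_of_le_ne_top (by simp) h)
    have hmn : m ≤ n := by exact_mod_cast hm'.symm.trans_le h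
    obtain ⟨h', hs⟩ := (total_hasPath_iff hl L (hmn.trans hn)).1 hm
    exact ⟨h'.dist_le.trans (by exact_mod_cast hmn), hs⟩
  · rintro ⟨h, hs⟩
    obtain ⟨m, hm, hm'⟩ := exists_hasPath_of_dist_ne_top (ne_top_of_le_ne_top (by simp) h)
    have hmn : m ≤ n := by exact_mod_cast hm'.symm.trans_le h
    exact ((total_hasPath_iff hl L (hmn.trans hn)).2 ⟨hm, hs⟩).dist_le.trans
      (by exact_mod_cast hmn)

lemma map_inv_map {g g' : X.fundGrpd l} (γ : g ⟶ g') (t : L.obj (op g')) :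
    L.map (Groupoid.inv γ).op (L.map γ.op t) = t := by
  refine (L.map_comp_apply γ.op (Groupoid.inv γ).op t).symm.trans ?_
  rw [← op_comp, Groupoid.inv_comp, op_id, L.map_id_apply]

lemma map_map_inv {g g' : X.fundGrpd l} (γ : g ⟶ g') (t : L.obj (op g)) :
    L.map γ.op (L.map (Groupoid.inv γ).op t) = t := by
  refine (L.map_comp_apply (Groupoid.inv γ).op γ.op t).symm.trans ?_
  rw [← op_comp, Groupoid.comp_inv, op_id, L.map_id_apply]

/-- The digraph over `X` defined by a presheaf on `Πˡ(X)` is an `l`-covering. -/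
theorem lCovering_total : (lCovering l).overObj ((total l hl X).obj L) := by
  refine lCovering_iff.2 fun n _ hn => ⟨?_, ?_⟩
  · rintro ⟨x, s⟩ y h
    -- The presheaf acts from the head of an arrow to its tail, so lifting from the tail uses the
    -- inverse morphism of the groupoid.
    refine ⟨⟨y, L.map (Groupoid.inv (distArrow (h.trans (by exact_mod_cast hn)))).op s⟩,
      ⟨(total_dist_le_iff hl L hn).2 ⟨h, (map_map_inv L _ _).symm⟩, rfl⟩, ?_⟩
    rintro ⟨y', t⟩ ⟨h₁, h₂⟩
    obtain rfl : y' = y := h₂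
    obtain ⟨_, hs⟩ := (total_dist_le_iff hl L hn).1 h₁
    exact Sigma.ext rfl (heq_of_eq ((map_inv_map L _ t).symm.trans (congrArg _ hs.symm)))
  · rintro ⟨y, t⟩ x h
    refine ⟨⟨x, L.map (distArrow (h.trans (by exact_mod_cast hn))).op t⟩,
      ⟨(total_dist_le_iff hl L hn).2 ⟨h, rfl⟩, rfl⟩, ?_⟩
    rintro ⟨x', s⟩ ⟨h₁, h₂⟩
    obtain rfl : x' = x := h₂
    obtain ⟨_, hs⟩ := (total_dist_le_iff hl L hn).1 h₁
    exact Sigma.ext rfl (heq_of_eq hs)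

end

/-! ### The presheaf of fibres of the covering defined by a presheaf -/

/-- The covering defined by a presheaf, as a functor. -/
def presheafCov (hl : 1 ≤ l) (X : Digr.{u}) : ((X.fundGrpd l)ᵒᵖ ⥤ Type u) ⥤ Cov l X :=
  ObjectProperty.lift _ (total l hl X) (lCovering_total hl)

section

variable (hl : 1 ≤ l) (L : (X.fundGrpd l)ᵒᵖ ⥤ Type u)

/-- The projection of the fundamental groupoid of the covering defined by a presheaf. -/
def totalProj : ((total l hl X).obj L).left.fundGrpd l ⥤ X.fundGrpd l :=
  SSet.fundGrpd.mapFunctor ((nerve l).map ((total l hl X).obj L).hom)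

/-- The element of the presheaf given by a point of the covering defined by it. -/
def totalPoint (b : ((total l hl X).obj L).left.fundGrpd l) :
    L.obj (op ((totalProj hl L).obj b)) :=
  L.map (eqToHom (vertex_eq ((totalProj hl L).obj b)).symm).op (b.as.as.1 0).2

lemma totalPoint_vertex (e : ((total l hl X).obj L).left.V) :
    totalPoint hl L (vertex l e) = e.2 :=
  L.map_id_apply _ _

/-- On an edge this is the description of distances at most `l` in the total digraph; functoriality
of `L` extends it to all morphisms. -/
lemma totalPoint_map {b' b : ((total l hl X).obj L).left.fundGrpd l} (φ : b' ⟶ b) :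
    L.map ((totalProj hl L).map φ).op (totalPoint hl L b) = totalPoint hl L b' := by
  induction φ using SSet.fundGrpd.hom_induction with
  | @h_edge x y ε =>
    obtain ⟨a, rfl⟩ : ∃ a, vertexSimplex l a = x := ⟨_, vertexSimplex_eq x⟩
    obtain ⟨b, rfl⟩ : ∃ b, vertexSimplex l b = y := ⟨_, vertexSimplex_eq y⟩
    obtain ⟨h, hε⟩ := edge_eq_distArrow ε
    obtain ⟨h', hab⟩ := (total_dist_le_iff hl L le_rfl).1 h
    have key : (totalProj hl L).map (SSet.fundGrpd.edge ε) = distArrow h' := by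
      rw [hε]
      refine (SSet.fundGrpd.mapFunctor_edge _ _).trans (congrArg SSet.fundGrpd.edge ?_)
      refine SSet.Edge.ext (Subtype.ext (funext fun (i : Fin 2) => ?_))
      fin_cases i <;> rfl
    rw [key]
    refine Eq.trans ?_ (hab.symm.trans (totalPoint_vertex hl L a).symm)
    exact congrArg _ (totalPoint_vertex hl L b)
  | h_comp f g hf hg =>
    rw [Functor.map_comp, op_comp]
    refine (L.map_comp_apply _ _ _).trans ((congrArg _ hg).trans hf)
  | h_inv f hf =>
    have hinv : (totalProj hl L).map (Groupoid.inv f) = Groupoid.inv ((totalProj hl L).map f) := by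
      simp
    rw [hinv, ← hf]
    exact map_inv_map L _ _

/-- The comparison of the fibres of the covering defined by a presheaf with the presheaf. -/
def totalFibreMap (g : X.fundGrpd l)
    (h : Grpd.Cov.Fibre ((presheafCov hl X ⋙ covNerve hl X ⋙ SSet.covFundGrpd _).obj L) g) :
    L.obj (op g) :=
  L.map (eqToHom h.2.symm).op (totalPoint hl L h.1)

lemma totalFibreMap_bijective (g : X.fundGrpd l) :
    Function.Bijective (totalFibreMap hl L g) := by
  obtain ⟨x, rfl⟩ : ∃ x, vertex l x = g := ⟨_, vertex_eq g⟩
  -- In this normal form the transports along `eqToHom` in `totalFibreMap` are identities.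
  have hform (h : Grpd.Cov.Fibre ((presheafCov hl X ⋙ covNerve hl X ⋙ SSet.covFundGrpd _).obj L)
      (vertex l x)) : ∃ a : L.obj (op (vertex l x)),
        h = ⟨vertex l (X := ((total l hl X).obj L).left) ⟨x, a⟩, rfl⟩ := by
    obtain ⟨⟨⟨x', a⟩, hx⟩, rfl⟩ := (fibreEquiv hl ((presheafCov hl X).obj L) x).symm.surjective h
    obtain rfl : x' = x := hx
    exact ⟨a, rfl⟩
  have hval (a : L.obj (op (vertex l x))) : totalFibreMap hl L (vertex l x)
      ⟨vertex l (X := ((total l hl X).obj L).left) ⟨x, a⟩, rfl⟩ = a :=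
    (L.map_id_apply _ _).trans (totalPoint_vertex hl L ⟨x, a⟩)
  refine ⟨fun h h' heq => ?_, fun a => ⟨_, hval a⟩⟩
  obtain ⟨a, rfl⟩ := hform h
  obtain ⟨a', rfl⟩ := hform h'
  rw [hval, hval] at heq
  rw [heq]

lemma totalFibreMap_transport {g' g : X.fundGrpd l} (γ : g' ⟶ g)
    (h : Grpd.Cov.Fibre ((presheafCov hl X ⋙ covNerve hl X ⋙ SSet.covFundGrpd _).obj L) g) :
    totalFibreMap hl L g' (Grpd.Cov.transport _ γ h) = L.map γ.op (totalFibreMap hl L g h) := by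
  obtain ⟨φ, hφ⟩ := Grpd.Cov.isTransport_transport _ γ h
  generalize Grpd.Cov.transport _ γ h = h' at φ hφ
  obtain ⟨b, rfl⟩ := h
  obtain ⟨b', rfl⟩ := h'
  obtain rfl : γ = (totalProj hl L).map φ :=
    @IsHomLift.eq_of_isHomLift _ _ _ _ (totalProj hl L) _ _ γ φ hφ
  refine (L.map_id_apply _ _).trans ((totalPoint_map hl L φ).symm.trans ?_)
  exact congrArg _ (L.map_id_apply _ _).symm

end

lemma totalFibreMap_naturality (hl : 1 ≤ l) {L M : (X.fundGrpd l)ᵒᵖ ⥤ Type u} (f : L ⟶ M)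
    (g : X.fundGrpd l)
    (h : Grpd.Cov.Fibre ((presheafCov hl X ⋙ covNerve hl X ⋙ SSet.covFundGrpd _).obj L) g) :
    totalFibreMap hl M g (Grpd.Cov.mapFibre
      ((presheafCov hl X ⋙ covNerve hl X ⋙ SSet.covFundGrpd _).map f) h) =
      f.app (op g) (totalFibreMap hl L g h) := by
  obtain ⟨b, rfl⟩ := h
  obtain ⟨e, rfl⟩ : ∃ e, vertex l e = b := ⟨_, vertex_eq b⟩
  refine (M.map_id_apply _ _).trans ((M.map_id_apply _ _).trans ?_)
  exact congrArg _ ((L.map_id_apply _ _).trans (L.map_id_apply _ _)).symm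

/-- The fibres of the covering defined by a presheaf recover the presheaf. -/
def presheafCovCompIso (hl : 1 ≤ l) (X : Digr.{u}) :
    presheafCov hl X ⋙ covPresheaf hl X ≅ 𝟭 ((X.fundGrpd l)ᵒᵖ ⥤ Type u) :=
  NatIso.ofComponents
    (fun L => NatIso.ofComponents
      (fun g => (Equiv.ofBijective _ (totalFibreMap_bijective hl L g.unop)).toIso)
      fun γ => ConcreteCategory.hom_ext _ _ fun h => totalFibreMap_transport hl L γ.unop h)
    fun f => NatTrans.ext (funext fun g => ConcreteCategory.hom_ext _ _ fun h =>
      totalFibreMap_naturality hl f g.unop h)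

/-! ### The equivalences -/

section

variable (hl : 1 ≤ l) (X : Digr.{u})

lemma essSurj_covPresheaf : (covPresheaf hl X).EssSurj :=
  ⟨fun L => ⟨_, ⟨(presheafCovCompIso hl X).app L⟩⟩⟩

include hl in
lemma isEquivalence_fibreFunctor : (Grpd.fibreFunctor (X.fundGrpd l)).IsEquivalence where
  essSurj := ⟨fun L => ⟨_, ⟨(presheafCovCompIso hl X).app L⟩⟩⟩

/-- Composing with the fully faithful fibre functor gives an essentially surjective functor, and a
fully faithful last factor can be cancelled. -/
lemma essSurj_covNerve_comp : (covNerve hl X ⋙ SSet.covFundGrpd _).EssSurj :=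
  have : ((covNerve hl X ⋙ SSet.covFundGrpd _) ⋙ Grpd.fibreFunctor _).EssSurj :=
    essSurj_covPresheaf hl X
  Functor.essSurj_of_comp_fully_faithful _ (Grpd.fibreFunctor _)

include hl in
lemma isEquivalence_covFundGrpd : (SSet.covFundGrpd ((nerve l).obj X)).IsEquivalence where
  essSurj := ⟨fun p =>
    have := essSurj_covNerve_comp hl X
    ⟨_, ⟨(covNerve hl X ⋙ SSet.covFundGrpd _).objObjPreimageIso p⟩⟩⟩

lemma isEquivalence_covNerve : (covNerve hl X).IsEquivalence where
  essSurj :=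
    have := essSurj_covNerve_comp hl X
    Functor.essSurj_of_comp_fully_faithful _ (SSet.covFundGrpd _)

end

end Digr

end

theorem theorem3p9 (l : ℕ) (hl : 1 ≤ l) (X : Digr.{u}) :
    ∃ (Φ₁ : Digr.Cov l X ≌ SSet.Cov ((Digr.nerve l).obj X))
      (Φ₂ : SSet.Cov ((Digr.nerve l).obj X) ≌ Grpd.Cov (X.fundGrpd l))
      (Φ₃ : Grpd.Cov (X.fundGrpd l) ≌ ((X.fundGrpd l)ᵒᵖ ⥤ Type u)),
      -- the first equivalence sends `p` to `𝒩ˡ(p)`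
      Φ₁.functor ⋙ ObjectProperty.ι _ = ObjectProperty.ι _ ⋙ Over.post (Digr.nerve l) ∧
      -- the second equivalence applies the fundamental groupoid functor
      Φ₂.functor ⋙ ObjectProperty.ι _ = ObjectProperty.ι _ ⋙ Over.post SSet.fundGrpd ∧
      -- the third equivalence takes fibres with transport by unique lifting
      Φ₃.functor = Grpd.fibreFunctor (X.fundGrpd l) ∧
      -- the composite sends `p` to its fibres `p⁻¹(x)`, naturally in `p`, and acts on an arrow
      -- `(x', x)` by sending `e ∈ p⁻¹(x)` to the unique `e' ∈ p⁻¹(x')` with `(e', e) ∈ E₁`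
      (∃ θ : ∀ x : X.V,
          ((Φ₁.trans Φ₂).trans Φ₃).functor ⋙
              (evaluation (X.fundGrpd l)ᵒᵖ (Type u)).obj (op (Digr.vertex l x)) ≅
            ObjectProperty.ι _ ⋙ Digr.fibre x,
        ∀ (p : Digr.Cov l X) (x' x : X.V) (h : X.E₁ x' x)
          (s : (((Φ₁.trans Φ₂).trans Φ₃).functor.obj p).obj (op (Digr.vertex l x)))
          (e' : (Digr.fibre x').obj p.obj),
          p.obj.left.E₁ e'.1 ((θ x).hom.app p s).1 ↔
            e' = (θ x').hom.app p
              ((((Φ₁.trans Φ₂).trans Φ₃).functor.obj p).map (Digr.arrow hl h).op s)) ∧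
      -- the inverse of the composite sends a presheaf `L` to the explicit covering with vertices
      -- `∐ₓ L(x)` and arrows `(L((x', x))(e), e)`
      (∃ hL : ∀ L : (X.fundGrpd l)ᵒᵖ ⥤ Type u,
          (Digr.lCovering l).overObj ((Digr.total l hl X).obj L),
        Nonempty (((Φ₁.trans Φ₂).trans Φ₃).inverse ≅
          ObjectProperty.lift _ (Digr.total l hl X) hL)) := by
  have h₁ := Digr.isEquivalence_covNerve hl X
  have h₂ := Digr.isEquivalence_covFundGrpd hl X
  have h₃ := Digr.isEquivalence_fibreFunctor hl X
  refine ⟨(Digr.covNerve hl X).asEquivalence, (SSet.covFundGrpd _).asEquivalence,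
    (Grpd.fibreFunctor _).asEquivalence, rfl, rfl, rfl,
    ⟨fun x => Digr.covPresheafEvaluationIso hl x, fun p x' x h s e' =>
      Digr.E₁_fibreEquiv_iff hl p h s e'⟩, Digr.lCovering_total hl, ⟨?_⟩⟩
  let Φ := ((Digr.covNerve hl X).asEquivalence.trans (SSet.covFundGrpd _).asEquivalence).trans
    (Grpd.fibreFunctor (X.fundGrpd l)).asEquivalence
  -- A right inverse of an equivalence is its inverse: insert `presheafCov hl X` followed by `Φ`
  -- before `Φ.inverse`, then cancel `Φ` against `Φ.inverse`.
  exact (Functor.leftUnitor _).symm ≪≫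
    Functor.isoWhiskerRight (Digr.presheafCovCompIso hl X).symm Φ.inverse ≪≫
    Functor.associator _ _ _ ≪≫
    Functor.isoWhiskerLeft (Digr.presheafCov hl X) Φ.unitIso.symm ≪≫
    Functor.rightUnitor _
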